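/- **Theorem.** The following problem can be solved in polynomial time. *Input.* A finite (abstract) simplicial complex $K$, given by the list of all its simplices (each as a set of vertices); a nonnegative integer length, written in binary, for each edge of $K$; a dimension $d\ge 0$; and a $d$-dimensional cycle $z_0$ of $K$ over $\mathbb{Z}_2$, which represents the homology class $h=[z_0]\in H_d(K;\mathbb{Z}_2)$. *Output.* A cycle $z_r\in h$ (that is, a $d$-cycle with $[z_r]=h$ in $H_d(K;\mathbb{Z}_2)$) of minimal radius: $\operatorname{rad}(z_r)\le\operatorname{rad}(z)$ for every cycle $z\in h$. Here $\operatorname{dist}(p,q)\in\mathbb{Z}_{\ge 0}\cup\{\infty\}$ is the length of a shortest path between the vertices $p$ and $q$ in the 1-skeleton of $K$ ($\infty$ if there is none), and the radius of a cycle is $$\operatorname{rad}(z)=\min_{p\in \operatorname{vert}(K)}\ \max_{q\in \operatorname{vert}(z)}\operatorname{dist}(p,q),$$ where $\operatorname{vert}(K)$ is the set of vertices of $K$ and $\operatorname{vert}(z)$ is the set of vertices of the simplices that occur in $z$ (the maximum over the empty set being $0$ and the minimum over the empty set being $\infty$). Polynomial time means that a single program of a random access machine, whose elementary steps are assignments,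 additions and truncated subtractions of natural numbers, indexed memory accesses and tests for zero, solves every instance in a number of steps that is bounded by a polynomial in the number of binary digits of the input. -/

import Mathlib

noncomputable section

/-! ### Random access machines with a step count -/

namespace RAM

/-- Memory of a random access machine: registers `reg 0, reg 1, …` and arrays
`arr 0, arr 1, …`, all cells holding natural numbers. A program mentions only finitely many
registers and arrays by name; array cells are addressed through registers. -/
@[ext]
structure State where
  reg : ℕ → ℕ
  arr : ℕ → ℕ → ℕ

/-- The elementary instructions. There is deliberately no multiplication and no shift: in one step
the largest number in memory gains at most one bit (up to the constants of the program), so that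
counting instructions agrees up to a polynomial with the time of a Turing machine. -/
inductive Instr where
  /-- `r := k` -/
  | const (r k : ℕ)
  /-- `r := x` -/
  | copy (r x : ℕ)
  /-- `r := x + y` -/
  | add (r x y : ℕ)
  /-- `r := x - y`, and `0` if `x < y` -/
  | sub (r x y : ℕ)
  /-- `r := a[i]`, the index being the content of register `i` -/
  | load (r a i : ℕ)
  /-- `a[i] := x`, the index being the content of register `i` -/
  | store (a i x : ℕ)

/-- The effect of an elementary instruction. -/
def Instr.apply : Instr → State → State
  | .const r k, s => { s with reg := Function.update s.reg r k }
  | .copy r x, s => { s with reg := Function.update s.reg r (s.reg x) }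
  | .add r x y, s => { s with reg := Function.update s.reg r (s.reg x + s.reg y) }
  | .sub r x y, s => { s with reg := Function.update s.reg r (s.reg x - s.reg y) }
  | .load r a i, s => { s with reg := Function.update s.reg r (s.arr a (s.reg i)) }
  | .store a i x, s =>
      { s with arr := Function.update s.arr a (Function.update (s.arr a) (s.reg i) (s.reg x)) }

/-- Programs: elementary instructions combined by sequencing, by a conditional and by a loop,
the last two testing whether a register is nonzero. -/
inductive Prog where
  | skip
  | instr (i : Instr)
  | seq (c₁ c₂ : Prog)
  | ifNonzero (x : ℕ) (c₁ c₂ : Prog)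
  | whileNonzero (x : ℕ) (c : Prog)

/-- `Run c s s' t`: started in the state `s`, the program `c` halts in the state `s'` after exactly
`t` steps. Every elementary instruction and every test is one step. -/
inductive Run : Prog → State → State → ℕ → Prop
  | skip (s : State) : Run .skip s s 1
  | instr (i : Instr) (s : State) : Run (.instr i) s (i.apply s) 1
  | seq {c₁ c₂ : Prog} {s s' s'' : State} {t₁ t₂ : ℕ} :
      Run c₁ s s' t₁ → Run c₂ s' s'' t₂ → Run (.seq c₁ c₂) s s'' (t₁ + t₂)
  | ifTrue {x : ℕ} {c₁ c₂ : Prog} {s s' : State} {t : ℕ} :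
      s.reg x ≠ 0 → Run c₁ s s' t → Run (.ifNonzero x c₁ c₂) s s' (t + 1)
  | ifFalse {x : ℕ} {c₁ c₂ : Prog} {s s' : State} {t : ℕ} :
      s.reg x = 0 → Run c₂ s s' t → Run (.ifNonzero x c₁ c₂) s s' (t + 1)
  | whileDone {x : ℕ} {c : Prog} {s : State} :
      s.reg x = 0 → Run (.whileNonzero x c) s s 1
  | whileStep {x : ℕ} {c : Prog} {s s' s'' : State} {t₁ t₂ : ℕ} :
      s.reg x ≠ 0 → Run c s s' t₁ → Run (.whileNonzero x c) s' s'' t₂ →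
        Run (.whileNonzero x c) s s'' (t₁ + t₂ + 1)

/-- The initial state on the input word `w`: array `0` holds `w`, register `0` holds its length,
and everything else is `0`. -/
def init (w : List ℕ) : State where
  reg := Function.update 0 0 w.length
  arr := Function.update 0 0 (fun i => w.getD i 0)

/-- The output of a state is the word `w`: register `0` holds the length of `w`, and array `1`
starts with the entries of `w`. -/
def Outputs (s : State) (w : List ℕ) : Prop :=
  s.reg 0 = w.length ∧ ∀ i, ∀ h : i < w.length, s.arr 1 i = w[i]

/-- The size of a word of natural numbers: the number of binary digits of its entries, plus one
separator for each entry. -/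
def size (w : List ℕ) : ℕ := (w.map fun a => Nat.size a + 1).sum

/-- The search problem "given an instance `a`, written as the word `enc a`, find a word `w` with
`Sol a w`" is solvable in polynomial time: one program solves all instances, with a number of
steps bounded by one polynomial in the size of the input word. -/
def PolyTimeSolvable {α : Type} (enc : α → List ℕ) (Sol : α → List ℕ → Prop) : Prop :=
  ∃ (c : Prog) (P : Polynomial ℕ), ∀ a : α, ∃ (s : State) (t : ℕ) (w : List ℕ),
    Run c (init (enc a)) s t ∧ t ≤ P.eval (size (enc a)) ∧ Outputs s w ∧ Sol a w

end RAM

/-! ### Simplicial homology over `ℤ/2` -/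

namespace CycleLocalization

variable {n : ℕ} (K : AbstractSimplicialComplex (Fin n))

/-- The simplices of `K` with exactly `k` vertices, i.e. those of dimension `k - 1`. There are none
for `k = 0`, because simplices are nonempty. -/
abbrev Simplex (k : ℕ) : Type := {σ : Finset (Fin n) // σ ∈ K.faces ∧ σ.card = k}

instance (k : ℕ) : Fintype (Simplex K k) := Fintype.ofFinite _

/-- The mod 2 chains made of simplices with `k` vertices. So `d`-dimensional chains are
`Chain K (d + 1)`. -/
abbrev Chain (k : ℕ) : Type := Simplex K k → ZMod 2

/-- The boundary operator `∂_d` from `d`-dimensional chains to `(d - 1)`-dimensional chains: the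
coefficient of `τ` in `∂ c` is the sum of the coefficients in `c` of the `d`-simplices that contain
`τ`. For `d = 0` the target is the zero space. -/
def boundary (d : ℕ) : Chain K (d + 1) →ₗ[ZMod 2] Chain K d where
  toFun c τ := ∑ σ : Simplex K (d + 1), if τ.1 ⊆ σ.1 then c σ else 0
  map_add' c c' := by
    funext τ
    simp only [Pi.add_apply, ← Finset.sum_add_distrib]
    refine Finset.sum_congr rfl fun σ _ => ?_
    split_ifs <;> simp
  map_smul' a c := by
    funext τ
    simp [Finset.mul_sum]

/-- The group `Z_d(K)` of `d`-dimensional cycles. -/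
abbrev Cycles (d : ℕ) : Submodule (ZMod 2) (Chain K (d + 1)) := LinearMap.ker (boundary K d)

/-- The group `B_d(K)` of `d`-dimensional boundaries. -/
abbrev Boundaries (d : ℕ) : Submodule (ZMod 2) (Chain K (d + 1)) :=
  LinearMap.range (boundary K (d + 1))

/-- The homology group `H_d(K) = Z_d(K) / B_d(K)`. -/
abbrev Homology (d : ℕ) : Type := Cycles K d ⧸ (Boundaries K d).submoduleOf (Cycles K d)

/-- The homology class of a cycle. -/
abbrev homologyClass {d : ℕ} (z : Cycles K d) : Homology K d := Submodule.Quotient.mk z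

/-! ### Geodesic distance and radius -/

/-- The 1-skeleton of `K`. -/
def oneSkeleton : SimpleGraph (Fin n) where
  Adj u v := u ≠ v ∧ ({u, v} : Finset (Fin n)) ∈ K.faces
  symm := ⟨fun u v h => ⟨h.1.symm, by rw [Finset.pair_comm]; exact h.2⟩⟩
  loopless := ⟨fun _ h => h.1 rfl⟩

variable {K}

/-- The edge of `K` that underlies a directed edge of the 1-skeleton. -/
def edgeOfDart (e : (oneSkeleton K).Dart) : Simplex K 2 :=
  ⟨{e.fst, e.snd}, e.adj.2, Finset.card_pair e.adj.1⟩

/-- The length of a path in the 1-skeleton, for given edge lengths. -/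
def pathLength (len : Simplex K 2 → ℕ) {p q : Fin n} (w : (oneSkeleton K).Walk p q) : ℕ :=
  (w.darts.map fun e => len (edgeOfDart e)).sum

/-- The geodesic distance: the length of a shortest path in the 1-skeleton, and `⊤` if there is
no path. -/
def geodist (len : Simplex K 2 → ℕ) (p q : Fin n) : ℕ∞ :=
  ⨅ w : (oneSkeleton K).Walk p q, (pathLength len w : ℕ∞)

/-- The vertices of a chain: the vertices of the simplices that occur in it. -/
def chainVertices {k : ℕ} (c : Chain K k) : Set (Fin n) := {q | ∃ σ, c σ ≠ 0 ∧ q ∈ σ.1}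

/-- The radius `min_p max_q dist(p, q)`, where `p` runs through the vertices of `K` and `q` through
those of the chain. It is `⊤` if no vertex of `K` is at finite distance from all of them. -/
def radius (len : Simplex K 2 → ℕ) {k : ℕ} (c : Chain K k) : ℕ∞ :=
  ⨅ p : Fin n, ⨆ q ∈ chainVertices c, geodist len p q

/-- `z` is a representative cycle of the class `h` whose radius is the least one among all
representative cycles of `h`. -/
def IsMinRadiusCycle (len : Simplex K 2 → ℕ) {d : ℕ} (h : Homology K d) (z : Cycles K d) : Prop :=
  homologyClass K z = h ∧
    ∀ z' : Cycles K d, homologyClass K z' = h → radius len z.1 ≤ radius len z'.1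

/-! ### The computational problem -/

/-- An instance of the problem: a finite simplicial complex with vertex set `Fin n` (every vertex
being a simplex), listed with its simplices in any order, a length for each edge, a dimension `d`,
and a `d`-cycle that represents the homology class in question. -/
structure Instance where
  n : ℕ
  K : AbstractSimplicialComplex (Fin n)
  simplices : List {σ : Finset (Fin n) // σ ∈ K.faces}
  nodup : simplices.Nodup
  complete : ∀ σ, σ ∈ simplices
  len : Simplex K 2 → ℕ
  d : ℕ
  z₀ : Cycles K d

/-- The value at `σ` of a function on the simplices with `k` vertices, extended by zero. -/
def valueAt {M : Type} [Zero M] {k : ℕ} (f : Simplex K k → M)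
    (σ : {σ : Finset (Fin n) // σ ∈ K.faces}) : M :=
  if h : σ.1.card = k then f ⟨σ.1, σ.2, h⟩ else 0

/-- The input word: the number of vertices, the dimension `d`, the number of simplices and then, for
each simplex of the list, the bits that tell which vertices it has, its length if it is an edge
(otherwise `0`), and its coefficient in the given cycle (`0` if its dimension is not `d`). -/
def Instance.encode (I : Instance) : List ℕ :=
  I.n :: I.d :: I.simplices.length :: I.simplices.flatMap fun σ =>
    (List.ofFn fun v : Fin I.n => if v ∈ σ.1 then 1 else 0) ++
      [valueAt I.len σ, (valueAt I.z₀.1 σ).val]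

/-- A `d`-cycle as a word: its coefficients at the simplices, in the order of the list (`0` at the
simplices whose dimension is not `d`). -/
def Instance.encodeCycle (I : Instance) (z : Cycles I.K I.d) : List ℕ :=
  I.simplices.map fun σ => (valueAt z.1 σ).val

/-- A word solves the instance if it describes a cycle of minimal radius in the class of the given
cycle. -/
def Instance.Solution (I : Instance) (w : List ℕ) : Prop :=
  ∃ z : Cycles I.K I.d,
    IsMinRadiusCycle I.len (homologyClass I.K I.z₀) z ∧ w = I.encodeCycle z

end CycleLocalization

end

/-! Fix a vertex `p` and give each `d`-simplex the largest distance of one of its vertices from `p`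
as its weight, so that the eccentricity of a cycle with respect to `p` is the largest weight of a
simplex that occurs in it. Gaussian elimination of the boundaries that treats the simplices in the
order of decreasing weight turns the given cycle into a homologous one of least eccentricity: if a
simplex `s` cannot be removed from the reduced cycle, then every homologous cycle contains a simplex
whose weight is at least that of `s`. The radius being the least eccentricity, the best of the
cycles for the vertices `p` has minimal radius.

The algorithm is written in a small language whose programs compute square tables of numbers and
whose loops all run as often as the input has numbers. Only their nesting depth enters the exponent
of the running time, and no multiplication is available, so every program of this language runs in
polynomial time on a random access machine. -/

namespace RAM

/-! ### A table language compiled to random access machines -/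

section Language

variable (T : Type)

/-- Expressions over the input word and over tables named by `T`, with de Bruijn variables. The only
recursion runs over the numbers below the length of the input, so that evaluation takes polynomial
time. -/
inductive Expr where
  | const (k : ℕ)
  | var (i : ℕ)
  | inputLength
  | input (e : Expr)
  | add (e₁ e₂ : Expr)
  | sub (e₁ e₂ : Expr)
  /-- the value of `e₁` if `c` is nonzero and that of `e₂` otherwise -/
  | ite (c e₁ e₂ : Expr)
  | load (a : T) (e₁ e₂ : Expr)
  /-- starting from `e₀`, update an accumulator (variable `1`) by `e` for each value of the index
  (variable `0`) below the input length -/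
  | fold (e₀ e : Expr)

/-- Commands on tables. -/
inductive Cmd where
  /-- assign to all entries of the table `a` simultaneously; in `e` variable `0` is the row and
  variable `1` the column -/
  | assign (a : T) (e : Expr T)
  | seq (c₁ c₂ : Cmd)
  /-- run `c` for each value of variable `0` below the input length -/
  | loop (c : Cmd)

/-- The contents of all tables. -/
abbrev Tables : Type := T → ℕ → ℕ → ℕ

variable {T}

/-- The value of an expression for the input word `w`. Tables are square, their size being the
length of the input, and reading outside of them gives `0`. -/
def Expr.eval (w : List ℕ) (σ : Tables T) : Expr T → List ℕ → ℕ
  | .const k, _ => k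
  | .var i, env => env.getD i 0
  | .inputLength, _ => w.length
  | .input e, env => w.getD (e.eval w σ env) 0
  | .add e₁ e₂, env => e₁.eval w σ env + e₂.eval w σ env
  | .sub e₁ e₂, env => e₁.eval w σ env - e₂.eval w σ env
  | .ite c e₁ e₂, env => if c.eval w σ env ≠ 0 then e₁.eval w σ env else e₂.eval w σ env
  | .load a e₁ e₂, env =>
    if e₁.eval w σ env < w.length ∧ e₂.eval w σ env < w.length then
      σ a (e₁.eval w σ env) (e₂.eval w σ env)
    else 0
  | .fold e₀ e, env =>
    Nat.fold w.length (fun k _ x => e.eval w σ (k :: x :: env)) (e₀.eval w σ env)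

/-- The effect of a command for the input word `w`. -/
def Cmd.exec [DecidableEq T] (w : List ℕ) : Cmd T → List ℕ → Tables T → Tables T
  | .assign a e, env, σ => Function.update σ a fun i j => e.eval w σ (i :: j :: env)
  | .seq c₁ c₂, env, σ => c₂.exec w env (c₁.exec w env σ)
  | .loop c, env, σ => Nat.fold w.length (fun k _ σ => c.exec w (k :: env) σ) σ

end Language

/-- Started in `s`, the program `c` halts within `t` steps in a state that satisfies `Q`. -/
def Exec (c : Prog) (t : ℕ) (s : State) (Q : State → Prop) : Prop :=
  ∃ s' t', Run c s s' t' ∧ t' ≤ t ∧ Q s'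

section Exec

variable {c c₁ c₂ : Prog} {t t₁ t₂ : ℕ} {s : State} {Q Q' : State → Prop}

theorem Exec.mono (h : Exec c t₁ s Q) (ht : t₁ ≤ t₂) (hQ : ∀ s', Q s' → Q' s') :
    Exec c t₂ s Q' := by
  obtain ⟨s', t', hrun, ht', hs'⟩ := h
  exact ⟨s', t', hrun, ht'.trans ht, hQ s' hs'⟩

theorem Exec.instr {i : Instr} (h : Q (i.apply s)) : Exec (.instr i) 1 s Q :=
  ⟨_, _, .instr i s, le_rfl, h⟩

theorem Exec.seq (h₁ : Exec c₁ t₁ s Q) (h₂ : ∀ s', Q s' → Exec c₂ t₂ s' Q') :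
    Exec (.seq c₁ c₂) (t₁ + t₂) s Q' := by
  obtain ⟨s', t₁', hrun₁, ht₁, hs'⟩ := h₁
  obtain ⟨s'', t₂', hrun₂, ht₂, hs''⟩ := h₂ s' hs'
  exact ⟨s'', _, .seq hrun₁ hrun₂, add_le_add ht₁ ht₂, hs''⟩

theorem Exec.instr_seq {i : Instr} (h : Exec c t (i.apply s) Q) :
    Exec (.seq (.instr i) c) (1 + t) s Q :=
  (Exec.instr (Q := (· = i.apply s)) rfl).seq fun _ hs' => hs' ▸ h

theorem Exec.ite {x : ℕ} (h₁ : s.reg x ≠ 0 → Exec c₁ t s Q) (h₂ : s.reg x = 0 → Exec c₂ t s Q) :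
    Exec (.ifNonzero x c₁ c₂) (t + 1) s Q := by
  by_cases hx : s.reg x = 0
  · obtain ⟨s', t', hrun, ht, hs'⟩ := h₂ hx
    exact ⟨s', _, .ifFalse hx hrun, Nat.succ_le_succ ht, hs'⟩
  · obtain ⟨s', t', hrun, ht, hs'⟩ := h₁ hx
    exact ⟨s', _, .ifTrue hx hrun, Nat.succ_le_succ ht, hs'⟩

end Exec

/-- The states differ at most in the registers from `δ` on. Compiled expressions use these registers
as a stack. -/
structure AgreeBelow (δ : ℕ) (s s' : State) : Prop where
  arr : s'.arr = s.arr
  reg : ∀ r < δ, s'.reg r = s.reg r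

namespace AgreeBelow

variable {δ δ' : ℕ} {s s' s'' : State}

theorem trans (h : AgreeBelow δ s s') (h' : AgreeBelow δ s' s'') : AgreeBelow δ s s'' :=
  ⟨h'.arr.trans h.arr, fun r hr => (h'.reg r hr).trans (h.reg r hr)⟩

theorem mono (h : AgreeBelow δ' s s') (hδ : δ ≤ δ') : AgreeBelow δ s s' :=
  ⟨h.arr, fun r hr => h.reg r (hr.trans_le hδ)⟩

theorem update {r x : ℕ} (hr : δ ≤ r) :
    AgreeBelow δ s { s with reg := Function.update s.reg r x } :=
  ⟨rfl, fun _ hr' => Function.update_of_ne (hr'.trans_le hr).ne x s.reg⟩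

end AgreeBelow

/-! #### Counting loops -/

/-- Run `body` with register `δ` counting from `0` to the content of register `0`. -/
def forProg (δ : ℕ) (body : Prog) : Prog :=
  .seq (.instr (.const δ 0)) <| .seq (.instr (.copy (δ + 1) 0)) <| .whileNonzero (δ + 1) <|
    .seq body <| .seq (.instr (.const (δ + 2) 1)) <| .seq (.instr (.add δ δ (δ + 2))) <|
      .instr (.sub (δ + 1) (δ + 1) (δ + 2))

theorem exec_whileNonzero {x n t : ℕ} {body : Prog} {P : ℕ → State → Prop}
    (hbody : ∀ k < n, ∀ s, P k s → s.reg x = n - k →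
      Exec body t s fun s' => P (k + 1) s' ∧ s'.reg x = n - (k + 1)) :
    ∀ j k s, k + j = n → P k s → s.reg x = j →
      Exec (.whileNonzero x body) (j * (t + 1) + 1) s (P n) := by
  intro j
  induction j with
  | zero =>
    intro k s hk hP hx
    exact ⟨s, 1, .whileDone hx, by omega, by simpa [← hk] using hP⟩
  | succ j ih =>
    intro k s hk hP hx
    obtain ⟨s₁, t₁, hrun₁, ht₁, hP₁, hx₁⟩ := hbody k (by omega) s hP (by omega)
    obtain ⟨s₂, t₂, hrun₂, ht₂, hP₂⟩ := ih (k + 1) s₁ (by omega) hP₁ (by omega)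
    refine ⟨s₂, _, .whileStep (by omega) hrun₁ hrun₂, ?_, hP₂⟩
    rw [Nat.succ_mul]
    omega

theorem exec_forProg {δ n t : ℕ} {body : Prog} {s : State} (P : ℕ → State → Prop) (hδ : 0 < δ)
    (hn : s.reg 0 = n) (hcongr : ∀ k s s', P k s → AgreeBelow δ s s' → P k s') (h₀ : P 0 s)
    (hbody : ∀ k < n, ∀ s, P k s → s.reg δ = k → Exec body t s fun s' =>
      P (k + 1) s' ∧ s'.reg δ = s.reg δ ∧ s'.reg (δ + 1) = s.reg (δ + 1)) :
    Exec (forProg δ body) (n * (t + 4) + 3) s (P n) := by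
  suffices h : Exec (forProg δ body) (1 + (1 + (n * (t + (1 + (1 + 1)) + 1) + 1))) s
      fun s' => P n s' ∧ s'.reg δ = n from h.mono (by ring_nf; rfl) fun _ => And.left
  refine .instr_seq (.instr_seq ?_)
  refine exec_whileNonzero (P := fun k s => P k s ∧ s.reg δ = k) ?_ n 0 _ (zero_add n) ⟨?_, ?_⟩ ?_
  · rintro k hk s ⟨hP, hs⟩ hx
    refine (hbody k hk s hP hs).seq fun s' ⟨hP', hδ', hx'⟩ => ?_
    refine .instr_seq (.instr_seq (.instr ⟨⟨hcongr _ _ _ hP' ?_, ?_⟩, ?_⟩))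
    · exact ((AgreeBelow.update (by omega)).trans (.update le_rfl)).trans (.update (by omega))
    · simp [Instr.apply, hδ', hs]
    · simp [Instr.apply, hx', hx, Nat.sub_sub]
  · exact hcongr _ _ _ h₀ ((AgreeBelow.update le_rfl).trans (.update (by omega)))
  · simp [Instr.apply]
  · simp [Instr.apply, hn, hδ.ne]

/-- A bound on the running time of a counting loop, for a bound on that of its body. -/
noncomputable def loopCost (P : Polynomial ℕ) : Polynomial ℕ := .X * (P + 4) + 3

@[simp]
theorem eval_loopCost (P : Polynomial ℕ) (n : ℕ) :
    (loopCost P).eval n = n * (P.eval n + 4) + 3 := by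
  simp [loopCost]

/-! #### Computing numbers -/

/-- Started in `s`, the program `c` leaves `x` in register `δ` within `t` steps, and it changes
no other memory than the registers from `δ` on. -/
def Computes (c : Prog) (t δ x : ℕ) (s : State) : Prop :=
  Exec c t s fun s' => AgreeBelow δ s s' ∧ s'.reg δ = x

section Computes

variable {c c₁ c₂ c₃ : Prog} {t t₁ t₂ t₃ δ x y z : ℕ} {s s' : State}

theorem Computes.of_agreeBelow (h : Computes c t δ x s') (hs : AgreeBelow δ s s') :
    Exec c t s' fun s'' => AgreeBelow δ s s'' ∧ s''.reg δ = x :=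
  h.mono le_rfl fun _ hs' => ⟨hs.trans hs'.1, hs'.2⟩

theorem Computes.mono (h : Computes c t₁ δ x s) (ht : t₁ ≤ t₂) : Computes c t₂ δ x s :=
  Exec.mono h ht fun _ => id

theorem computes_const : Computes (.instr (.const δ x)) 1 δ x s :=
  .instr ⟨.update le_rfl, Function.update_self ..⟩

theorem computes_copy {r : ℕ} (hr : s.reg r = x) : Computes (.instr (.copy δ r)) 1 δ x s :=
  .instr ⟨.update le_rfl, by simp [Instr.apply, hr]⟩

theorem computes_load {a i : ℕ} (hx : s.arr a (s.reg i) = x) :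
    Computes (.instr (.load δ a i)) 1 δ x s :=
  .instr ⟨.update le_rfl, by simp [Instr.apply, hx]⟩

theorem Computes.seq (h₁ : Computes c₁ t₁ δ x s)
    (h₂ : ∀ s', AgreeBelow δ s s' → s'.reg δ = x → Computes c₂ t₂ δ y s') :
    Computes (.seq c₁ c₂) (t₁ + t₂) δ y s :=
  Exec.seq h₁ fun s' ⟨hs, hx⟩ => (h₂ s' hs hx).of_agreeBelow hs

theorem Computes.seq_succ (h₁ : Computes c₁ t₁ (δ + 1) x s)
    (h₂ : ∀ s', AgreeBelow (δ + 1) s s' → s'.reg (δ + 1) = x → Computes c₂ t₂ δ y s') :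
    Computes (.seq c₁ c₂) (t₁ + t₂) δ y s :=
  Exec.seq h₁ fun s' ⟨hs, hx⟩ => (h₂ s' hs hx).of_agreeBelow (hs.mono δ.le_succ)

theorem Computes.binary (h₁ : Computes c₁ t₁ δ x s)
    (h₂ : ∀ s', AgreeBelow δ s s' → Computes c₂ t₂ (δ + 1) y s')
    (h₃ : ∀ s', AgreeBelow δ s s' → s'.reg δ = x → s'.reg (δ + 1) = y → Computes c₃ t₃ δ z s') :
    Computes (.seq c₁ (.seq c₂ c₃)) (t₁ + (t₂ + t₃)) δ z s :=
  h₁.seq fun s₁ hs₁ hx => (h₂ s₁ hs₁).seq_succ fun s₂ hs₂ hy =>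
    h₃ s₂ (hs₁.trans (hs₂.mono δ.le_succ)) ((hs₂.reg δ δ.lt_succ_self).trans hx) hy

theorem Computes.add (h₁ : Computes c₁ t₁ δ x s)
    (h₂ : ∀ s', AgreeBelow δ s s' → Computes c₂ t₂ (δ + 1) y s') :
    Computes (.seq c₁ (.seq c₂ (.instr (.add δ δ (δ + 1))))) (t₁ + (t₂ + 1)) δ (x + y) s :=
  h₁.binary h₂ fun _ _ hx hy => .instr ⟨.update le_rfl, by simp [Instr.apply, hx, hy]⟩

theorem Computes.sub (h₁ : Computes c₁ t₁ δ x s)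
    (h₂ : ∀ s', AgreeBelow δ s s' → Computes c₂ t₂ (δ + 1) y s') :
    Computes (.seq c₁ (.seq c₂ (.instr (.sub δ δ (δ + 1))))) (t₁ + (t₂ + 1)) δ (x - y) s :=
  h₁.binary h₂ fun _ _ hx hy => .instr ⟨.update le_rfl, by simp [Instr.apply, hx, hy]⟩

theorem Computes.ite (h : Computes c t δ x s)
    (h₁ : ∀ s', AgreeBelow δ s s' → Computes c₁ t₁ δ y s')
    (h₂ : ∀ s', AgreeBelow δ s s' → Computes c₂ t₂ δ z s') :
    Computes (.seq c (.ifNonzero δ c₁ c₂)) (t + (t₁ + t₂ + 1)) δ (if x ≠ 0 then y else z) s := by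
  refine h.seq fun s' hs hx => Exec.ite (fun hne => ?_) (fun heq => ?_)
  · rw [if_pos (hx ▸ hne)]
    exact (h₁ s' hs).mono (Nat.le_add_right _ _)
  · rw [if_neg (by rw [← hx, heq]; exact not_not.2 rfl)]
    exact (h₂ s' hs).mono (Nat.le_add_left _ _)

theorem Computes.fold {body : Prog} {n : ℕ} {f : ℕ → ℕ → ℕ} (hδ : 0 < δ) (hn : s.reg 0 = n)
    (h₁ : Computes c₁ t₁ δ x s)
    (h₂ : ∀ k < n, ∀ y s', AgreeBelow δ s s' → s'.reg δ = y → s'.reg (δ + 1) = k →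
      Computes body t₂ (δ + 3) (f k y) s') :
    Computes (.seq c₁ (forProg (δ + 1) (.seq body (.instr (.copy δ (δ + 3))))))
      (t₁ + (n * (t₂ + 1 + 4) + 3)) δ (Nat.fold n (fun k _ y => f k y) x) s := by
  refine Exec.seq h₁ fun s₀ hs₀ => exec_forProg
    (fun k s' => AgreeBelow δ s s' ∧ s'.reg δ = Nat.fold k (fun k _ y => f k y) x)
    δ.succ_pos ((hs₀.1.reg 0 hδ).trans hn) ?_ hs₀ ?_
  · rintro k s₁ s₂ ⟨hs₁, hy⟩ h
    exact ⟨hs₁.trans (h.mono δ.le_succ), (h.reg δ δ.lt_succ_self).trans hy⟩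
  · rintro k hk s₁ ⟨hs₁, hy⟩ hk'
    refine Exec.seq (h₂ k hk _ s₁ hs₁ hy hk') fun s₂ ⟨hs₂, hy₂⟩ => .instr ⟨⟨?_, ?_⟩, ?_, ?_⟩
    · exact (hs₁.trans (hs₂.mono (by omega))).trans (.update le_rfl)
    · simp [Instr.apply, hy₂]
    · simpa [Instr.apply] using hs₂.reg (δ + 1) (by omega)
    · simpa [Instr.apply, add_assoc] using hs₂.reg (δ + 2) (by omega)

end Computes

/-! #### Compilation of expressions -/

/-- The flat index of the table entry whose row and column are held by the registers `x` and `y`: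
tables are stored row by row, and array `3` holds the multiples of the input length. -/
def indexProg (δ x y : ℕ) : Prog := .seq (.instr (.load δ 3 x)) (.instr (.add δ δ y))

/-- The entry of array `b` whose row and column are held by the registers `x` and `y`. -/
def entryProg (b δ x y : ℕ) : Prog := .seq (indexProg δ x y) (.instr (.load δ b δ))

/-- The entry of array `b` whose row and column are held by the registers `δ` and `δ + 1`, or `0` if
one of these is not below the content of register `0`. -/
def boundedEntryProg (b δ : ℕ) : Prog :=
  .seq (.instr (.sub (δ + 2) 0 δ)) <| .seq (.instr (.sub (δ + 3) 0 (δ + 1))) <|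
    .ifNonzero (δ + 2)
      (.ifNonzero (δ + 3) (entryProg b δ δ (δ + 1)) (.instr (.const δ 0)))
      (.instr (.const δ 0))

section

variable {b δ x y n i j : ℕ} {s : State}

theorem computes_index (hrow : s.arr 3 (s.reg x) = i * n) (hj : s.reg y = j) (hy : y ≠ δ) :
    Computes (indexProg δ x y) 2 δ (i * n + j) s :=
  Exec.instr_seq (t := 1) <| Exec.instr
    ⟨.trans (.update le_rfl) (.update le_rfl), by simp [Instr.apply, hrow, hj, hy]⟩

theorem computes_entry (hrow : s.arr 3 (s.reg x) = i * n) (hj : s.reg y = j) (hy : y ≠ δ) :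
    Computes (entryProg b δ x y) 3 δ (s.arr b (i * n + j)) s :=
  (computes_index hrow hj hy).seq fun s' hs hi => computes_load (by rw [hs.arr, hi])

theorem computes_boundedEntry (hn : s.reg 0 = n) (hrow : ∀ i < n, s.arr 3 i = i * n)
    (hi : s.reg δ = i) (hj : s.reg (δ + 1) = j) :
    Computes (boundedEntryProg b δ) 7 δ (if i < n ∧ j < n then s.arr b (i * n + j) else 0) s := by
  refine .instr_seq (t := 6) (.instr_seq (t := 5) ?_)
  set s' := (Instr.sub (δ + 3) 0 (δ + 1)).apply ((Instr.sub (δ + 2) 0 δ).apply s)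
  have hs : AgreeBelow δ s s' := .trans (.update (by omega)) (.update (by omega))
  have hi' : s'.reg (δ + 2) = n - i := by simp [s', Instr.apply, hn, hi]
  have hj' : s'.reg (δ + 3) = n - j := by simp [s', Instr.apply, hn, hj]
  refine Exec.ite (fun hin => Exec.ite (fun hjn => ?_) fun hjn => ?_) fun hin => ?_
  · rw [if_pos (by omega), ← hs.arr]
    refine (computes_entry ?_ ?_ (by omega)).of_agreeBelow hs
    · simp [s', Instr.apply, hi, hrow i (by omega)]
    · simp [s', Instr.apply, hj]
  · rw [if_neg (by omega)]
    exact (computes_const.mono (by omega)).of_agreeBelow hs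
  · rw [if_neg (by omega)]
    exact (computes_const.mono (by omega)).of_agreeBelow hs

end

variable {T : Type} [Encodable T]

/-- The array that holds the table `a`. -/
def tableArray (a : T) : ℕ := Encodable.encode a + 4

theorem tableArray_injective : Function.Injective (tableArray : T → ℕ) :=
  (add_left_injective 4).comp Encodable.encode_injective

/-- A program that leaves the value of an expression in register `δ`, where the variables are held
by the registers `ρ`. -/
def Expr.compile : Expr T → List ℕ → ℕ → Prog
  | .const k, _, δ => .instr (.const δ k)
  | .var i, ρ, δ => match ρ[i]? with
    | some r => .instr (.copy δ r)
    | none => .instr (.const δ 0)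
  | .inputLength, _, δ => .instr (.copy δ 0)
  | .input e, ρ, δ => .seq (e.compile ρ δ) (.instr (.load δ 0 δ))
  | .add e₁ e₂, ρ, δ => .seq (e₁.compile ρ δ) <| .seq (e₂.compile ρ (δ + 1)) <|
      .instr (.add δ δ (δ + 1))
  | .sub e₁ e₂, ρ, δ => .seq (e₁.compile ρ δ) <| .seq (e₂.compile ρ (δ + 1)) <|
      .instr (.sub δ δ (δ + 1))
  | .ite c e₁ e₂, ρ, δ => .seq (c.compile ρ δ) <| .ifNonzero δ (e₁.compile ρ δ) (e₂.compile ρ δ)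
  | .load a e₁ e₂, ρ, δ => .seq (e₁.compile ρ δ) <| .seq (e₂.compile ρ (δ + 1)) <|
      boundedEntryProg (tableArray a) δ
  | .fold e₀ e, ρ, δ => .seq (e₀.compile ρ δ) <| forProg (δ + 1) <|
      .seq (e.compile ((δ + 1) :: δ :: ρ) (δ + 3)) <| .instr (.copy δ (δ + 3))

/-- A bound on the number of steps for the evaluation of an expression, in terms of the length of
the input. -/
noncomputable def Expr.cost : Expr T → Polynomial ℕ
  | .const _ => 1
  | .var _ => 1
  | .inputLength => 1
  | .input e => e.cost + 1
  | .add e₁ e₂ => e₁.cost + (e₂.cost + 1)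
  | .sub e₁ e₂ => e₁.cost + (e₂.cost + 1)
  | .ite c e₁ e₂ => c.cost + (e₁.cost + e₂.cost + 1)
  | .load _ e₁ e₂ => e₁.cost + (e₂.cost + 7)
  | .fold e₀ e => e₀.cost + loopCost (e.cost + 1)

/-- The arrays hold the input word, the multiples of its length, and the tables. -/
structure Represents (w : List ℕ) (σ : Tables T) (arr : ℕ → ℕ → ℕ) : Prop where
  input : ∀ i, arr 0 i = w.getD i 0
  row : ∀ i < w.length, arr 3 i = i * w.length
  entry : ∀ a, ∀ i < w.length, ∀ j < w.length, arr (tableArray a) (i * w.length + j) = σ a i j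

/-- Besides the arrays representing `w` and `σ`, register `0` holds the length of the input, and the
registers `ρ`, which lie below `δ`, hold the values `env` of the variables. -/
structure Models (w : List ℕ) (σ : Tables T) (ρ env : List ℕ) (δ : ℕ) (s : State) : Prop where
  represents : Represents w σ s.arr
  pos : 0 < δ
  length : s.reg 0 = w.length
  vars : List.Forall₂ (fun r x => r < δ ∧ s.reg r = x) ρ env

namespace Models

variable {w : List ℕ} {σ σ' : Tables T} {ρ env : List ℕ} {δ δ' r x i : ℕ} {s s' : State}

theorem congr (h : Models w σ ρ env δ s) (harr : Represents w σ' s'.arr)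
    (hreg : ∀ r < δ, s'.reg r = s.reg r) (hδ : δ ≤ δ') : Models w σ' ρ env δ' s' where
  represents := harr
  pos := h.pos.trans_le hδ
  length := (hreg 0 h.pos).trans h.length
  vars := h.vars.imp fun r _ hr => ⟨hr.1.trans_le hδ, (hreg r hr.1).trans hr.2⟩

theorem of_agreeBelow (h : Models w σ ρ env δ s) (hs : AgreeBelow δ s s') (hδ : δ ≤ δ') :
    Models w σ ρ env δ' s' :=
  h.congr (hs.arr.symm ▸ h.represents) hs.reg hδ

theorem cons (h : Models w σ ρ env δ s) (hr : r < δ) (hx : s.reg r = x) :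
    Models w σ (r :: ρ) (x :: env) δ s :=
  { h with vars := .cons ⟨hr, hx⟩ h.vars }

theorem computes_var (h : Models w σ ρ env δ s) :
    Computes ((Expr.var i : Expr T).compile ρ δ) 1 δ (env.getD i 0) s := by
  have hlength := h.vars.length_eq
  rw [Expr.compile]
  by_cases hi : i < ρ.length
  · have hvar := h.vars.get hi (hlength ▸ hi)
    simp only [List.get_eq_getElem] at hvar
    rw [List.getElem?_eq_getElem hi, List.getD_eq_getElem _ _ (hlength ▸ hi)]
    exact computes_copy hvar.2
  · rw [List.getElem?_eq_none (not_lt.1 hi), List.getD_eq_default _ _ (hlength ▸ not_lt.1 hi)]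
    exact computes_const

theorem computes_boundedEntry (h : Models w σ ρ env δ s) (a : T) {i j : ℕ} (hi : s.reg δ = i)
    (hj : s.reg (δ + 1) = j) :
    Computes (boundedEntryProg (tableArray a) δ) 7 δ
      (if i < w.length ∧ j < w.length then σ a i j else 0) s := by
  have hentry := RAM.computes_boundedEntry (b := tableArray a) h.length h.represents.row hi hj
  split_ifs with hij
  · rwa [if_pos hij, h.represents.entry a i hij.1 j hij.2] at hentry
  · rwa [if_neg hij] at hentry

theorem computes (h : Models w σ ρ env δ s) (e : Expr T) :
    Computes (e.compile ρ δ) (e.cost.eval w.length) δ (e.eval w σ env) s := by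
  induction e generalizing ρ env δ s with
  | const k => exact computes_const.mono (by simp [Expr.cost])
  | var i => exact h.computes_var.mono (by simp [Expr.cost])
  | inputLength => exact (computes_copy h.length).mono (by simp [Expr.cost])
  | input e ih =>
    simp only [Expr.cost, Polynomial.eval_add, Polynomial.eval_one]
    exact (ih h).seq fun s' hs hi => computes_load (by rw [hs.arr, h.represents.input, hi]; rfl)
  | add e₁ e₂ ih₁ ih₂ =>
    simp only [Expr.cost, Polynomial.eval_add, Polynomial.eval_one]
    exact (ih₁ h).add fun s' hs => ih₂ (h.of_agreeBelow hs δ.le_succ)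
  | sub e₁ e₂ ih₁ ih₂ =>
    simp only [Expr.cost, Polynomial.eval_add, Polynomial.eval_one]
    exact (ih₁ h).sub fun s' hs => ih₂ (h.of_agreeBelow hs δ.le_succ)
  | ite c e₁ e₂ ih ih₁ ih₂ =>
    simp only [Expr.cost, Polynomial.eval_add, Polynomial.eval_one]
    exact (ih h).ite (fun s' hs => ih₁ (h.of_agreeBelow hs le_rfl))
      fun s' hs => ih₂ (h.of_agreeBelow hs le_rfl)
  | load a e₁ e₂ ih₁ ih₂ =>
    simp only [Expr.cost, Polynomial.eval_add, Polynomial.eval_ofNat]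
    exact (ih₁ h).binary (fun s' hs => ih₂ (h.of_agreeBelow hs δ.le_succ)) fun s' hs hi hj =>
      (h.of_agreeBelow hs le_rfl).computes_boundedEntry a hi hj
  | fold e₀ e ih₀ ih =>
    simp only [Expr.cost, Polynomial.eval_add, eval_loopCost, Polynomial.eval_one]
    refine (ih₀ h).fold h.pos h.length fun k _ y s' hs hy hk' => ih ?_
    exact ((h.of_agreeBelow hs (by omega)).cons (by omega) hy).cons (by omega) hk'

end Models

/-! #### Compilation of commands -/

/-- From the state `s` the state `s'` has been reached by writing `g 0, …, g (m - 1)` to the first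
cells of array `b`; otherwise at most the registers from `δ` on have changed. -/
structure Filled (b δ : ℕ) (g : ℕ → ℕ) (m : ℕ) (s s' : State) : Prop where
  reg : ∀ r < δ, s'.reg r = s.reg r
  arr : ∀ a, a ≠ b → s'.arr a = s.arr a
  entry : ∀ k < m, s'.arr b k = g k

namespace Filled

variable {b δ δ' m x y : ℕ} {g : ℕ → ℕ} {s s' s'' : State}

theorem zero : Filled b δ g 0 s s := ⟨fun _ _ => rfl, fun _ _ => rfl, by simp⟩

theorem of_agreeBelow (h : Filled b δ g m s s') (hs : AgreeBelow δ' s' s'') (hδ : δ ≤ δ') :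
    Filled b δ g m s s'' where
  reg r hr := (hs.reg r (hr.trans_le hδ)).trans (h.reg r hr)
  arr a ha := hs.arr.symm ▸ h.arr a ha
  entry := hs.arr.symm ▸ h.entry

theorem store (h : Filled b δ g m s s') (hx : s'.reg x = m) (hy : s'.reg y = g m) :
    Filled b δ g (m + 1) s ((Instr.store b x y).apply s') where
  reg := h.reg
  arr a ha := by simp [Instr.apply, ha, h.arr a ha]
  entry k hk := by
    obtain hk | rfl := Nat.lt_succ_iff_lt_or_eq.1 hk
    · simp [Instr.apply, hx, hk.ne, h.entry k hk]
    · simp [Instr.apply, hx, hy]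

end Filled

/-- Write to the first cells of array `b`, as many as register `0` tells, the numbers that `code`
leaves in register `δ + 2`; the index of the cell is held by register `δ`. -/
def tabulateProg (b δ : ℕ) (code : Prog) : Prog :=
  forProg δ (.seq code (.instr (.store b δ (δ + 2))))

/-- Write to the entry of the table in array `b` whose row and column are held by the registers `δ`
and `δ + 2` the number that `code` leaves in register `δ + 5`. -/
def fillEntryProg (b δ : ℕ) (code : Prog) : Prog :=
  .seq (indexProg (δ + 4) δ (δ + 2)) (.seq code (.instr (.store b (δ + 4) (δ + 5))))

/-- Write to all entries of the table in array `b` the numbers that `code` leaves in register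
`δ + 5`; the row and the column are held by the registers `δ` and `δ + 2`. -/
def fillProg (b δ : ℕ) (code : Prog) : Prog :=
  forProg δ (forProg (δ + 2) (fillEntryProg b δ code))

section

variable {b δ n t i j : ℕ} {code : Prog} {s s' : State} {g : ℕ → ℕ}

theorem exec_tabulateProg (hδ : 0 < δ) (hn : s.reg 0 = n)
    (hcode : ∀ k < n, ∀ s', Filled b δ g k s s' → s'.reg δ = k →
      Computes code t (δ + 2) (g k) s') :
    Exec (tabulateProg b δ code) (n * (t + 1 + 4) + 3) s (Filled b δ g n s) := by
  refine exec_forProg (Filled b δ g · s) hδ hn (fun _ _ _ h hs => h.of_agreeBelow hs le_rfl) .zero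
    fun k hk s₁ h₁ hk₁ => ?_
  refine Exec.seq (hcode k hk s₁ h₁ hk₁) fun s₂ ⟨hs, hg⟩ => .instr ⟨?_, ?_, ?_⟩
  · exact (h₁.of_agreeBelow hs (by omega)).store ((hs.reg δ (by omega)).trans hk₁) hg
  · exact hs.reg δ (by omega)
  · exact hs.reg (δ + 1) (by omega)

theorem exec_fillEntryProg (hrow : s'.arr 3 (s'.reg δ) = i * n) (hj : s'.reg (δ + 2) = j)
    (hs' : Filled b δ g (i * n + j) s s')
    (hcode : ∀ s'', AgreeBelow (δ + 4) s' s'' → Computes code t (δ + 5) (g (i * n + j)) s'') :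
    Exec (fillEntryProg b δ code) (2 + (t + 1)) s' fun s'' =>
      Filled b δ g (i * n + j + 1) s s'' ∧ ∀ r < δ + 4, s''.reg r = s'.reg r := by
  refine Exec.seq (computes_index hrow hj (by omega)) fun s₁ ⟨hs₁, hindex⟩ => ?_
  refine Exec.seq (hcode s₁ hs₁) fun s₂ ⟨hs₂, hg⟩ => .instr ⟨?_, ?_⟩
  · exact ((hs'.of_agreeBelow hs₁ (by omega)).of_agreeBelow hs₂ (by omega)).store
      ((hs₂.reg _ (Nat.lt_succ_self _)).trans hindex) hg
  · exact fun r hr => (hs₂.reg r (by omega)).trans (hs₁.reg r hr)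

theorem exec_fillProg (hδ : 0 < δ) (hn : s.reg 0 = n) (hb : b ≠ 3)
    (hrow : ∀ i < n, s.arr 3 i = i * n)
    (hcode : ∀ i < n, ∀ j < n, ∀ s', Filled b δ g (i * n + j) s s' → s'.reg δ = i →
      s'.reg (δ + 2) = j → Computes code t (δ + 5) (g (i * n + j)) s') :
    Exec (fillProg b δ code) (n * (n * (2 + (t + 1) + 4) + 3 + 4) + 3) s
      (Filled b δ g (n * n) s) := by
  refine exec_forProg (fun i => Filled b δ g (i * n) s) hδ hn
    (fun _ _ _ h hs => h.of_agreeBelow hs le_rfl) (by simpa using Filled.zero)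
    fun i hi s₁ h₁ hi₁ => ?_
  suffices hcolumns : Exec (forProg (δ + 2) (fillEntryProg b δ code))
      (n * (2 + (t + 1) + 4) + 3) s₁ fun s' =>
      Filled b δ g (i * n + n) s s' ∧ ∀ r < δ + 2, s'.reg r = s₁.reg r from
    hcolumns.mono le_rfl fun s₂ ⟨h₂, hr₂⟩ =>
      ⟨by rwa [Nat.succ_mul], hr₂ δ (by omega), hr₂ (δ + 1) (by omega)⟩
  refine exec_forProg
    (fun j s' => Filled b δ g (i * n + j) s s' ∧ ∀ r < δ + 2, s'.reg r = s₁.reg r)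
    (by omega) ((h₁.reg 0 hδ).trans hn) (fun _ _ _ h hs =>
      ⟨h.1.of_agreeBelow hs (by omega), fun r hr => (hs.reg r hr).trans (h.2 r hr)⟩)
    ⟨h₁, fun _ _ => rfl⟩ fun j hj s₂ ⟨h₂, hr₂⟩ hj₂ => ?_
  have hi₂ : s₂.reg δ = i := (hr₂ δ (by omega)).trans hi₁
  refine (exec_fillEntryProg ?_ hj₂ h₂ fun s₃ hs₃ => ?_).mono le_rfl fun s₃ ⟨h₃, hr₃⟩ =>
    ⟨⟨h₃, fun r hr => (hr₃ r (by omega)).trans (hr₂ r hr)⟩, hr₃ _ (by omega), hr₃ _ (by omega)⟩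
  · rw [hi₂, h₂.arr 3 hb.symm, hrow i hi]
  · exact hcode i hi j hj s₃ (h₂.of_agreeBelow hs₃ (by omega))
      ((hs₃.reg δ (by omega)).trans hi₂) ((hs₃.reg (δ + 2) (by omega)).trans hj₂)

end

/-- A bound on the running time of `fillProg`, for a bound on that of its code. -/
noncomputable def fillCost (P : Polynomial ℕ) : Polynomial ℕ := loopCost (loopCost (2 + (P + 1)))

variable {T : Type} [Encodable T]

/-- A program for a command, where the variables are held by the registers `ρ`. The new values of a
table are first collected in array `2`, because they may depend on the old ones. -/
def Cmd.compile : Cmd T → List ℕ → ℕ → Prog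
  | .assign a e, ρ, δ => .seq
      (fillProg 2 δ (e.compile (δ :: (δ + 2) :: ρ) (δ + 5)))
      (fillProg (tableArray a) δ (entryProg 2 (δ + 5) δ (δ + 2)))
  | .seq c₁ c₂, ρ, δ => .seq (c₁.compile ρ δ) (c₂.compile ρ δ)
  | .loop c, ρ, δ => forProg δ (c.compile (δ :: ρ) (δ + 2))

/-- A bound on the number of steps of a command, in terms of the length of the input. -/
noncomputable def Cmd.cost : Cmd T → Polynomial ℕ
  | .assign _ e => fillCost e.cost + fillCost 3
  | .seq c₁ c₂ => c₁.cost + c₂.cost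
  | .loop c => loopCost c.cost

namespace Represents

variable {w : List ℕ} {σ : Tables T} {arr arr' : ℕ → ℕ → ℕ}

/-- Arrays `1` and `2` are scratch memory: the output and the buffer for assignments. -/
theorem congr (h : Represents w σ arr) (harr : ∀ a, a ≠ 1 → a ≠ 2 → arr' a = arr a) :
    Represents w σ arr' where
  input i := by rw [harr 0 (by omega) (by omega), h.input i]
  row i hi := by rw [harr 3 (by omega) (by omega), h.row i hi]
  entry a := by
    rw [harr _ (by simp [tableArray]) (by simp [tableArray])]
    exact h.entry a

theorem update [DecidableEq T] {a : T} {f : ℕ → ℕ → ℕ} (h : Represents w σ arr)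
    (harr : ∀ b, b ≠ tableArray a → arr' b = arr b)
    (hf : ∀ i < w.length, ∀ j < w.length, arr' (tableArray a) (i * w.length + j) = f i j) :
    Represents w (Function.update σ a f) arr' where
  input i := by rw [harr 0 (by simp [tableArray]), h.input i]
  row i hi := by rw [harr 3 (by simp [tableArray]), h.row i hi]
  entry b := by
    obtain rfl | hb := eq_or_ne b a
    · simpa using hf
    · rw [harr _ (tableArray_injective.ne hb), Function.update_of_ne hb]
      exact h.entry b

end Represents

theorem div_eq_of_row {n i j : ℕ} (hj : j < n) : (i * n + j) / n = i := by
  rw [mul_comm, Nat.mul_add_div (j.zero_le.trans_lt hj), Nat.div_eq_of_lt hj, add_zero]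

theorem mod_eq_of_row {n i j : ℕ} (hj : j < n) : (i * n + j) % n = j := by
  rw [mul_comm, Nat.mul_add_mod, Nat.mod_eq_of_lt hj]

namespace Models

variable {w : List ℕ} {σ : Tables T} {ρ env : List ℕ} {δ : ℕ} {s : State}

theorem exec_fillBuffer (h : Models w σ ρ env δ s) (e : Expr T) :
    Exec (fillProg 2 δ (e.compile (δ :: (δ + 2) :: ρ) (δ + 5))) ((fillCost e.cost).eval w.length) s
      (Filled 2 δ (fun k => e.eval w σ (k / w.length :: k % w.length :: env))
        (w.length * w.length) s) := by
  refine (exec_fillProg (t := e.cost.eval w.length) h.pos h.length (by omega) h.represents.row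
    fun i _ j hj s' hs hi' hj' => ?_).mono (by simp [fillCost]) fun _ => id
  have hmodels : Models w σ ρ env (δ + 5) s' :=
    h.congr (h.represents.congr fun a _ => hs.arr a) hs.reg (by omega)
  rw [div_eq_of_row hj, mod_eq_of_row hj]
  exact ((hmodels.cons (by omega) hj').cons (by omega) hi').computes e

theorem exec_copyBuffer [DecidableEq T] {s₀ : State} {f : ℕ → ℕ → ℕ} {a : T}
    (h : Models w σ ρ env δ s₀)
    (hs : Filled 2 δ (fun k => f (k / w.length) (k % w.length)) (w.length * w.length) s₀ s) :
    Exec (fillProg (tableArray a) δ (entryProg 2 (δ + 5) δ (δ + 2)))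
      ((fillCost 3 : Polynomial ℕ).eval w.length) s fun s' =>
      Represents w (Function.update σ a f) s'.arr ∧ ∀ r < δ, s'.reg r = s₀.reg r := by
  have hbuffer : Represents w σ s.arr := h.represents.congr fun b _ => hs.arr b
  have hindex {i j : ℕ} (hi : i < w.length) (hj : j < w.length) :
      i * w.length + j < w.length * w.length :=
    mul_comm i w.length ▸ Nat.mul_add_lt_mul_of_lt_of_lt hi hj
  refine (exec_fillProg (t := 3) (g := fun k => f (k / w.length) (k % w.length)) h.pos
    ((hs.reg 0 h.pos).trans h.length) (by simp [tableArray]) hbuffer.row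
    fun i hi j hj s₁ hs₁ hi₁ hj₁ => ?_).mono (by simp [fillCost]) fun s₂ hs₂ => ⟨?_, fun r hr =>
      (hs₂.reg r hr).trans (hs.reg r hr)⟩
  · rw [← hs.entry _ (hindex hi hj), ← hs₁.arr 2 (by simp [tableArray])]
    refine computes_entry ?_ hj₁ (by omega)
    rw [hi₁, hs₁.arr 3 (by simp [tableArray]), hbuffer.row i hi]
  · refine hbuffer.update hs₂.arr fun i hi j hj => ?_
    rw [hs₂.entry _ (hindex hi hj), div_eq_of_row hj, mod_eq_of_row hj]

theorem exec [DecidableEq T] (h : Models w σ ρ env δ s) (c : Cmd T) :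
    Exec (c.compile ρ δ) (c.cost.eval w.length) s fun s' =>
      Represents w (c.exec w env σ) s'.arr ∧ ∀ r < δ, s'.reg r = s.reg r := by
  induction c generalizing σ ρ env δ s with
  | assign a e =>
    rw [Cmd.cost, Polynomial.eval_add]
    exact (h.exec_fillBuffer e).seq fun s₁ h₁ =>
      h.exec_copyBuffer (f := fun i j => e.eval w σ (i :: j :: env)) h₁
  | seq c₁ c₂ ih₁ ih₂ =>
    rw [Cmd.cost, Polynomial.eval_add]
    refine (ih₁ h).seq fun s₁ ⟨hσ₁, hr₁⟩ => (ih₂ (h.congr hσ₁ hr₁ le_rfl)).mono le_rfl ?_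
    exact fun s₂ ⟨hσ₂, hr₂⟩ => ⟨hσ₂, fun r hr => (hr₂ r hr).trans (hr₁ r hr)⟩
  | loop c ih =>
    rw [Cmd.cost, eval_loopCost]
    refine exec_forProg (fun k s' =>
      Represents w (Nat.fold k (fun k _ σ => c.exec w (k :: env) σ) σ) s'.arr ∧
      ∀ r < δ, s'.reg r = s.reg r) h.pos h.length ?_ ⟨h.represents, fun _ _ => rfl⟩ ?_
    · rintro k s₁ s₂ ⟨hσ₁, hr₁⟩ hs
      exact ⟨hs.arr.symm ▸ hσ₁, fun r hr => (hs.reg r hr).trans (hr₁ r hr)⟩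
    · rintro k - s₁ ⟨hσ₁, hr₁⟩ hk₁
      refine (ih ((h.congr hσ₁ hr₁ (δ.le_add_right 2)).cons (by omega) hk₁)).mono le_rfl ?_
      rintro s₂ ⟨hσ₂, hr₂⟩
      refine ⟨⟨?_, fun r hr => (hr₂ r (by omega)).trans (hr₁ r hr)⟩, hr₂ δ (by omega),
        hr₂ (δ + 1) (by omega)⟩
      rwa [Nat.fold_succ]

end Models

/-! #### Complete programs -/

/-- Leave in register `δ` the product of the contents of the registers `0` and `x`. -/
def mulProg (δ x : ℕ) : Prog :=
  .seq (.instr (.const δ 0)) <| forProg (δ + 1) <|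
    .seq (.instr (.add (δ + 3) δ x)) (.instr (.copy δ (δ + 3)))

theorem computes_mulProg {δ n x y : ℕ} {s : State} (hn : s.reg 0 = n) (hx : s.reg x = y)
    (hδ : x < δ) : Computes (mulProg δ x) (1 + (n * (1 + 1 + 4) + 3)) δ (y * n) s := by
  have hfold (m : ℕ) : Nat.fold m (fun _ _ z => z + y) 0 = y * m := by
    induction m with
    | zero => rfl
    | succ m ih => rw [Nat.fold_succ, ih, Nat.mul_succ]
  rw [← hfold]
  refine computes_const.fold (by omega) hn fun k _ z s' hs hz _ => .instr ⟨.update le_rfl, ?_⟩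
  simp [Instr.apply, hz, hs.reg x hδ, hx]

/-- Prepare the multiples of the input length, run `c`, then output the values of `out`, variable
`0` being the position in the output, whose length is given by `len`. -/
def Cmd.program (c : Cmd T) (out len : Expr T) : Prog :=
  .seq (tabulateProg 3 1 (mulProg 3 1)) <| .seq (c.compile [] 1) <|
    .seq (tabulateProg 1 1 (out.compile [1] 3)) <| .seq (len.compile [] 1) (.instr (.copy 0 1))

/-- A bound on the number of steps of the complete program, in terms of the length of the input. -/
noncomputable def Cmd.programCost (c : Cmd T) (out len : Expr T) : Polynomial ℕ :=
  loopCost (1 + loopCost 2 + 1) + (c.cost + (loopCost (out.cost + 1) + (len.cost + 1)))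

section

variable {w : List ℕ} {σ : Tables T}

theorem exec_init : Exec (tabulateProg 3 1 (mulProg 3 1))
    ((loopCost (1 + loopCost 2 + 1) : Polynomial ℕ).eval w.length) (init w)
    (Models w (0 : Tables T) [] [] 1) := by
  refine (exec_tabulateProg (n := w.length) (t := (1 + loopCost 2 : Polynomial ℕ).eval w.length)
    (g := fun k => k * w.length) one_pos rfl fun k _ s hs hk => ?_).mono (by simp) fun s hs => ?_
  · exact (computes_mulProg (n := w.length) (hs.reg 0 one_pos) hk (by omega)).mono (by simp)
  · refine ⟨⟨fun i => ?_, hs.entry, fun a i _ j _ => ?_⟩, one_pos, hs.reg 0 one_pos, .nil⟩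
    · rw [hs.arr 0 (by omega)]
      rfl
    · rw [hs.arr (tableArray a) (by simp [tableArray])]
      simp [init, tableArray]

theorem Models.exec_output {s : State} (h : Models w σ [] [] 1 s) {out len : Expr T}
    (hlen : len.eval w σ [] ≤ w.length) :
    Exec (.seq (tabulateProg 1 1 (out.compile [1] 3))
        (.seq (len.compile [] 1) (.instr (.copy 0 1))))
      ((loopCost (out.cost + 1) + (len.cost + 1)).eval w.length) s
      (Outputs · ((List.range (len.eval w σ [])).map fun k => out.eval w σ [k])) := by
  have hmodels {m s'} (hs : Filled 1 1 (fun k => out.eval w σ [k]) m s s') :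
      Models w σ [] [] 1 s' := h.congr (h.represents.congr fun a ha _ => hs.arr a ha) hs.reg le_rfl
  have hout := exec_tabulateProg (t := out.cost.eval w.length) h.pos h.length fun k _ s' hs hk =>
    (((hmodels hs).congr (hmodels hs).represents (fun _ _ => rfl) (by omega)).cons
      (by omega) hk).computes out
  refine (hout.seq fun s₁ hs₁ => Exec.seq ((hmodels hs₁).computes len) fun s₂ ⟨hs₂, hlen₂⟩ =>
    .instr (i := .copy 0 1) ⟨?_, fun k hk => ?_⟩).mono (by simp) fun _ => id
  · simp [Instr.apply, hlen₂]
  · rw [List.length_map, List.length_range] at hk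
    simp [Instr.apply, hs₂.arr, hs₁.entry k (hk.trans_le hlen)]

theorem monotone_polynomial_eval {R : Type*} [CommSemiring R] [PartialOrder R] [IsOrderedRing R]
    [CanonicallyOrderedAdd R] (P : Polynomial R) : Monotone fun x => P.eval x := by
  intro x y hxy
  induction P using Polynomial.induction_on' with
  | add p q hp hq => simpa using add_le_add hp hq
  | monomial k c =>
    simpa using mul_le_mul_of_nonneg_left (pow_le_pow_left₀ zero_le hxy k) zero_le

theorem length_le_size (w : List ℕ) : w.length ≤ size w := by
  induction w with
  | nil => simp
  | cons a w ih =>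
    simp only [size, List.map_cons, List.sum_cons, List.length_cons] at ih ⊢
    omega

theorem polyTimeSolvable_of_cmd [DecidableEq T] {α : Type} {enc : α → List ℕ}
    {Sol : α → List ℕ → Prop} (c : Cmd T) (out len : Expr T)
    (hlen : ∀ x, len.eval (enc x) (c.exec (enc x) [] 0) [] ≤ (enc x).length)
    (hsol : ∀ x, Sol x ((List.range (len.eval (enc x) (c.exec (enc x) [] 0) [])).map fun k =>
      out.eval (enc x) (c.exec (enc x) [] 0) [k])) :
    PolyTimeSolvable enc Sol := by
  refine ⟨c.program out len, c.programCost out len, fun x => ?_⟩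
  obtain ⟨s, t, hrun, ht, hout⟩ := exec_init.seq fun s hs => (hs.exec c).seq fun s' ⟨hσ, hr⟩ =>
    (hs.congr hσ hr le_rfl).exec_output (hlen x)
  rw [← Polynomial.eval_add, ← Polynomial.eval_add] at ht
  exact ⟨s, t, _, hrun, ht.trans (monotone_polynomial_eval _ (length_le_size _)), hout, hsol x⟩

end

/-! #### Derived expressions -/

section Derived

variable {T : Type}

theorem fold_induction {α : Type} {n : ℕ} {f : ∀ k < n, α → α} {x : α} (P : ℕ → α → Prop)
    (zero : P 0 x) (succ : ∀ k (hk : k < n) y, P k y → P (k + 1) (f k hk y)) :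
    P n (Nat.fold n f x) := by
  induction n with
  | zero => exact zero
  | succ n ih => exact succ n n.lt_succ_self _ (ih fun k hk => succ k (hk.trans n.lt_succ_self))

/-- The element of `ZMod 2` that is stored as `a`: every nonzero number stands for `1`. -/
def toZMod2 (a : ℕ) : ZMod 2 := if a ≠ 0 then 1 else 0

theorem toZMod2_ne_zero {a : ℕ} : toZMod2 a ≠ 0 ↔ a ≠ 0 := by
  simp [toZMod2]

theorem toZMod2_val (x : ZMod 2) : toZMod2 x.val = x := by
  revert x
  decide

theorem val_toZMod2 (a : ℕ) : (toZMod2 a).val = if a ≠ 0 then 1 else 0 := by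
  rw [toZMod2]
  split_ifs <;> rfl

/-- The tables that a command may change. -/
def Cmd.writes : Cmd T → List T
  | .assign a _ => [a]
  | .seq c₁ c₂ => c₁.writes ++ c₂.writes
  | .loop c => c.writes

variable {w env : List ℕ} {σ : Tables T}

theorem Cmd.exec_of_notMem_writes [DecidableEq T] {a : T} (c : Cmd T) (ha : a ∉ c.writes) :
    c.exec w env σ a = σ a := by
  induction c generalizing env σ with
  | assign b e => exact Function.update_of_ne (List.ne_of_not_mem_cons ha) _ _
  | seq c₁ c₂ ih₁ ih₂ =>
    rw [Cmd.writes, List.mem_append, not_or] at ha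
    exact (ih₂ ha.2).trans (ih₁ ha.1)
  | loop c ih =>
    exact fold_induction (fun _ (σ' : Tables T) => σ' a = σ a) rfl
      fun _ _ _ hσ' => (ih ha).trans hσ'

namespace Expr

/-- Nonzero if the value of `e₁` is less than that of `e₂`. -/
def lt (e₁ e₂ : Expr T) : Expr T := .sub e₂ e₁

/-- Nonzero if the values differ. -/
def ne (e₁ e₂ : Expr T) : Expr T := .add (.sub e₁ e₂) (.sub e₂ e₁)

/-- Nonzero if both values are. -/
def and (e₁ e₂ : Expr T) : Expr T := .ite e₁ e₂ (.const 0)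

/-- Nonzero if exactly one of the values is. -/
def xor (e₁ e₂ : Expr T) : Expr T := .ite e₁ (.ite e₂ (.const 0) (.const 1)) e₂

/-- The entry of the table `a` in row `e` and column `0`. -/
def load₁ (a : T) (e : Expr T) : Expr T := .load a e (.const 0)

/-- The entry of the table `a` in row `0` and column `0`. -/
def load₀ (a : T) : Expr T := .load a (.const 0) (.const 0)

/-- The sum of the values of `e`. As for the other iterated operations below, variable `0` of `e`
runs through the numbers below the input length, and variable `1` must not be used. -/
def sum (e : Expr T) : Expr T := .fold (.const 0) (.add (.var 1) e)

/-- The maximum of `0` and the values of `e`. -/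
def maximum (e : Expr T) : Expr T := .fold (.const 0) (.ite (lt (.var 1) e) e (.var 1))

/-- The minimum of the value of `e₀` and the values of `e`. -/
def minimum (e₀ e : Expr T) : Expr T := .fold e₀ (.ite (lt e (.var 1)) e (.var 1))

/-- A row in which the entry of the table `a` in column `j` is largest. -/
def argmax (a : T) (j : Expr T) : Expr T :=
  .fold (.const 0) (.ite (lt (.load a (.var 1) j) (.load a (.var 0) j)) (.var 0) (.var 1))

theorem eval_lt_ne_zero {e₁ e₂ : Expr T} :
    (lt e₁ e₂).eval w σ env ≠ 0 ↔ e₁.eval w σ env < e₂.eval w σ env :=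
  Nat.sub_ne_zero_iff_lt

theorem eval_ne_ne_zero {e₁ e₂ : Expr T} :
    (ne e₁ e₂).eval w σ env ≠ 0 ↔ e₁.eval w σ env ≠ e₂.eval w σ env := by
  simp only [ne, eval]
  omega

theorem eval_ite {c e₁ e₂ : Expr T} {P : Prop} [Decidable P] (h : c.eval w σ env ≠ 0 ↔ P) :
    (ite c e₁ e₂).eval w σ env = if P then e₁.eval w σ env else e₂.eval w σ env :=
  if_congr h rfl rfl

theorem eval_and_ne_zero {e₁ e₂ : Expr T} :
    (and e₁ e₂).eval w σ env ≠ 0 ↔ e₁.eval w σ env ≠ 0 ∧ e₂.eval w σ env ≠ 0 := by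
  simp only [and, eval]
  split_ifs with h <;> simp [h]

theorem toZMod2_eval_and {e₁ e₂ : Expr T} :
    toZMod2 ((and e₁ e₂).eval w σ env) =
      toZMod2 (e₁.eval w σ env) * toZMod2 (e₂.eval w σ env) := by
  simp only [and, eval, toZMod2]
  split_ifs <;> simp_all

theorem toZMod2_eval_xor {e₁ e₂ : Expr T} :
    toZMod2 ((xor e₁ e₂).eval w σ env) =
      toZMod2 (e₁.eval w σ env) + toZMod2 (e₂.eval w σ env) := by
  simp only [xor, eval, toZMod2]
  split_ifs <;> first | rfl | simp_all

theorem eval_load {a : T} {e₁ e₂ : Expr T} {i j : ℕ} (h₁ : e₁.eval w σ env = i)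
    (h₂ : e₂.eval w σ env = j) (hi : i < w.length) (hj : j < w.length) :
    (load a e₁ e₂).eval w σ env = σ a i j := by
  subst h₁ h₂
  exact if_pos ⟨hi, hj⟩

theorem eval_load₁ {a : T} {e : Expr T} {i : ℕ} (h : e.eval w σ env = i) (hi : i < w.length) :
    (load₁ a e).eval w σ env = σ a i 0 :=
  eval_load h rfl hi (i.zero_le.trans_lt hi)

theorem eval_load₀ {a : T} (hw : 0 < w.length) : (load₀ a).eval w σ env = σ a 0 0 :=
  eval_load rfl rfl hw hw

section Iterated

variable {e₀ e : Expr T} {f : ℕ → ℕ} (he : ∀ k < w.length, ∀ x, e.eval w σ (k :: x :: env) = f k)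

include he

theorem eval_sum : (sum e).eval w σ env = ∑ k ∈ Finset.range w.length, f k := by
  refine fold_induction (fun m x => x = ∑ k ∈ Finset.range m, f k) rfl fun k hk y hy => ?_
  rw [Finset.sum_range_succ, ← hy, ← he k hk y]
  rfl

theorem eval_maximum_le_iff {x : ℕ} :
    (maximum e).eval w σ env ≤ x ↔ ∀ k < w.length, f k ≤ x := by
  refine fold_induction (fun m y => y ≤ x ↔ ∀ k < m, f k ≤ x) (by simp [eval]) fun k hk y hy => ?_
  simp only [Nat.forall_lt_succ_right, ← hy, eval, lt, he k hk, List.getD_cons_succ,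
    List.getD_cons_zero]
  split_ifs <;> omega

theorem eval_minimum_le_iff {x : ℕ} :
    (minimum e₀ e).eval w σ env ≤ x ↔ e₀.eval w σ env ≤ x ∨ ∃ k < w.length, f k ≤ x := by
  refine fold_induction (fun m y => y ≤ x ↔ e₀.eval w σ env ≤ x ∨ ∃ k < m, f k ≤ x) (by simp)
    fun k hk y hy => ?_
  simp only [Nat.exists_lt_succ_right, ← or_assoc, ← hy, eval, lt, he k hk, List.getD_cons_succ,
    List.getD_cons_zero]
  split_ifs <;> omega

end Iterated

theorem eval_argmax {a : T} {e : Expr T} {j : ℕ} (hw : 0 < w.length) (hj : j < w.length)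
    (he : ∀ k x, e.eval w σ (k :: x :: env) = j) :
    (argmax a e).eval w σ env < w.length ∧
      ∀ i < w.length, σ a i j ≤ σ a ((argmax a e).eval w σ env) j := by
  refine fold_induction (fun m x => x < w.length ∧ ∀ i < m, σ a i j ≤ σ a x j) (by simpa [eval])
    fun k hk x ⟨hx, hmax⟩ => ?_
  have hk' : (load a (var 0) e).eval w σ (k :: x :: env) = σ a k j :=
    eval_load rfl (he k x) hk hj
  have hx' : (load a (var 1) e).eval w σ (k :: x :: env) = σ a x j :=
    eval_load rfl (he k x) hx hj
  simp only [Nat.forall_lt_succ_right]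
  rw [eval_ite (eval_lt_ne_zero.trans (by rw [hk', hx']))]
  split_ifs with h
  · exact ⟨hk, fun i hi => (hmax i hi).trans h.le, le_rfl⟩
  · exact ⟨hx, hmax, not_lt.1 h⟩

end Expr

end Derived

end RAM

namespace CycleLocalization

/-! ### Elimination in the order of decreasing weight -/

section Elimination

variable {𝕜 ι κ R : Type*} [Field 𝕜]

/-- The elimination step with pivot row `p` at the coordinate `s`, as a linear map: it subtracts the
multiple of `p` that makes the coordinate `s` vanish. It is the identity if `p s = 0`. -/
def clearAt (p : κ → 𝕜) (s : κ) : (κ → 𝕜) →ₗ[𝕜] (κ → 𝕜) :=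
  LinearMap.id - ((p s)⁻¹ • LinearMap.proj s).smulRight p

theorem clearAt_apply (p y : κ → 𝕜) (s : κ) : clearAt p s y = y - ((p s)⁻¹ * y s) • p := rfl

theorem clearAt_of_eq_zero (p : κ → 𝕜) {y : κ → 𝕜} {s : κ} (hy : y s = 0) : clearAt p s y = y := by
  simp [clearAt_apply, hy]

theorem clearAt_apply_self {p y : κ → 𝕜} {s : κ} (h : y s ≠ 0 → p s ≠ 0) :
    clearAt p s y s = 0 := by
  by_cases hy : y s = 0
  · rw [clearAt_of_eq_zero p hy, hy]
  · have := h hy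
    simp only [clearAt_apply, Pi.sub_apply, Pi.smul_apply, smul_eq_mul]
    field_simp
    ring

theorem clearAt_apply_of_eq_zero {p : κ → 𝕜} {r : κ} (hr : p r = 0) (s : κ) (y : κ → 𝕜) :
    clearAt p s y r = y r := by
  simp [clearAt_apply, hr]

theorem clearAt_sub_self_mem {B : Submodule 𝕜 (κ → 𝕜)} {p : κ → 𝕜} (hp : p ∈ B) (s : κ)
    (y : κ → 𝕜) : clearAt p s y - y ∈ B := by
  rw [clearAt_apply, sub_sub_cancel_left]
  exact B.neg_mem (B.smul_mem _ hp)

theorem pivot_ne_zero_of_mem_span {rows : ι → κ → 𝕜} {s : κ} {t : ι}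
    (ht : ∀ i, rows i s ≠ 0 → rows t s ≠ 0) {y : κ → 𝕜}
    (hy : y ∈ Submodule.span 𝕜 (Set.range rows)) (hys : y s ≠ 0) : rows t s ≠ 0 := by
  contrapose! hys with hts
  have hspan : Submodule.span 𝕜 (Set.range rows) ≤ LinearMap.ker (LinearMap.proj s) :=
    Submodule.span_le.2 (Set.range_subset_iff.2 fun i => by_contra fun hi => ht i hi hts)
  exact hspan hy

theorem span_range_clearAt {rows : ι → κ → 𝕜} {s : κ} {t : ι}
    (ht : ∀ i, rows i s ≠ 0 → rows t s ≠ 0) :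
    Submodule.span 𝕜 (Set.range fun i => clearAt (rows t) s (rows i)) =
      Submodule.span 𝕜 (Set.range rows) ⊓ LinearMap.ker (LinearMap.proj s) := by
  have hrow (i : ι) : rows i ∈ Submodule.span 𝕜 (Set.range rows) :=
    Submodule.subset_span ⟨i, rfl⟩
  refine le_antisymm (Submodule.span_le.2 (Set.range_subset_iff.2 fun i => ?_)) fun y hy => ?_
  · exact ⟨(Submodule.sub_mem_iff_left _ (hrow i)).1 (clearAt_sub_self_mem (hrow t) s _),
      clearAt_apply_self (ht i)⟩
  · have hys : y s = 0 := hy.2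
    have := Submodule.mem_map_of_mem (f := clearAt (rows t) s) hy.1
    rwa [Submodule.map_span, ← Set.range_comp, clearAt_of_eq_zero _ hys] at this

/-- The state of an elimination that has treated the coordinates in `Δ`: the rows span the vectors
of `B` that vanish on `Δ`, and `z`, an element of the coset `z₀ + B`, has been reduced: whenever an
element of `B` is nonzero somewhere on `Δ`, then `z` vanishes at one of its coordinates of largest
weight, so that adding it to `z` does not help. -/
structure EliminationState [Preorder R] (B : Submodule 𝕜 (κ → 𝕜)) (z₀ : κ → 𝕜) (W : κ → R)
    (rows : ι → κ → 𝕜) (z : κ → 𝕜) (Δ : Set κ) : Prop where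
  mem_span : ∀ y, y ∈ Submodule.span 𝕜 (Set.range rows) ↔ y ∈ B ∧ ∀ s ∈ Δ, y s = 0
  coset : z - z₀ ∈ B
  reduced : ∀ y ∈ B, (∃ s ∈ Δ, y s ≠ 0) → ∃ s ∈ Δ, y s ≠ 0 ∧ z s = 0 ∧ ∀ r, y r ≠ 0 → W r ≤ W s

namespace EliminationState

variable [Preorder R] {B : Submodule 𝕜 (κ → 𝕜)} {z₀ z : κ → 𝕜} {W : κ → R} {rows : ι → κ → 𝕜}
  {Δ : Set κ}

theorem initial (hB : Submodule.span 𝕜 (Set.range rows) = B) : EliminationState B z W rows z ∅ where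
  mem_span y := by simp [hB]
  coset := by simp
  reduced := by simp

theorem step (h : EliminationState B z₀ W rows z Δ) {s : κ} {t : ι}
    (hs : ∀ r ∉ Δ, (∃ y ∈ B, y r ≠ 0) → W r ≤ W s)
    (ht : ∀ i, rows i s ≠ 0 → rows t s ≠ 0) :
    EliminationState B z₀ W (fun i => clearAt (rows t) s (rows i)) (clearAt (rows t) s z)
      (insert s Δ) where
  mem_span y := by
    rw [span_range_clearAt ht, Submodule.mem_inf, h.mem_span, Set.forall_mem_insert, and_assoc,
      and_comm (a := y s = 0)]
    rfl
  coset := by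
    have hp := ((h.mem_span _).1 (Submodule.subset_span ⟨t, rfl⟩)).1
    rw [← sub_add_sub_cancel]
    exact add_mem (clearAt_sub_self_mem hp s z) h.coset
  reduced y hyB hy := by
    by_cases hyΔ : ∃ r ∈ Δ, y r ≠ 0
    · obtain ⟨r, hr, hyr, hzr, hW⟩ := h.reduced y hyB hyΔ
      have hpr := ((h.mem_span _).1 (Submodule.subset_span ⟨t, rfl⟩)).2 r hr
      exact ⟨r, Set.mem_insert_of_mem _ hr, hyr, (clearAt_apply_of_eq_zero hpr s z).trans hzr, hW⟩
    · push Not at hyΔ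
      have hys : y s ≠ 0 := by
        obtain ⟨r, rfl | hr, hyr⟩ := hy
        exacts [hyr, absurd (hyΔ r hr) hyr]
      have hts := pivot_ne_zero_of_mem_span ht ((h.mem_span y).2 ⟨hyB, hyΔ⟩) hys
      exact ⟨s, Set.mem_insert _ _, hys, clearAt_apply_self fun _ => hts, fun r hyr =>
        hs r (fun hr => hyr (hyΔ r hr)) ⟨y, hyB, hyr⟩⟩

theorem exists_weight_le (h : EliminationState B z₀ W rows z Δ)
    (hΔ : ∀ y ∈ B, ∀ r, y r ≠ 0 → r ∈ Δ) {z' : κ → 𝕜} (hz' : z' - z₀ ∈ B) {r : κ}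
    (hr : z r ≠ 0) : ∃ s, z' s ≠ 0 ∧ W r ≤ W s := by
  by_cases hzr : z' r = 0
  · have hy : z' - z ∈ B := by
      rw [← sub_sub_sub_cancel_right z' z z₀]
      exact sub_mem hz' h.coset
    have hyr : (z' - z) r ≠ 0 := by simpa [hzr] using hr
    obtain ⟨s, -, hys, hzs, hW⟩ := h.reduced _ hy ⟨r, hΔ _ hy r hyr, hyr⟩
    exact ⟨s, by simpa [hzs] using hys, hW r hyr⟩
  · exact ⟨r, hzr, le_rfl⟩

end EliminationState

end Elimination

/-! ### The boundary of a boundary -/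

section Boundary

variable {n : ℕ} {K : AbstractSimplicialComplex (Fin n)} {d : ℕ}

theorem boundary_apply (c : Chain K (d + 1)) (τ : Simplex K d) :
    boundary K d c τ = ∑ σ : Simplex K (d + 1), if τ.1 ⊆ σ.1 then c σ else 0 := rfl

theorem map_filter_between_eq_Ioo (ρ : Simplex K d) (τ : Simplex K (d + 2)) :
    ({σ : Simplex K (d + 1) | ρ.1 ⊆ σ.1 ∧ σ.1 ⊆ τ.1} : Finset _).map (.subtype _) =
      Finset.Ioo ρ.1 τ.1 := by
  ext σ
  simp only [Finset.mem_map, Finset.mem_filter, Finset.mem_univ, true_and,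
    Function.Embedding.subtype_apply, Finset.mem_Ioo]
  constructor
  · rintro ⟨σ, ⟨hρσ, hστ⟩, rfl⟩
    refine ⟨hρσ.ssubset_of_ne fun h => ?_, hστ.ssubset_of_ne fun h => ?_⟩
    · simpa [σ.2.2, ρ.2.2] using congrArg Finset.card h
    · simpa [σ.2.2, τ.2.2] using congrArg Finset.card h
  · rintro ⟨hρσ, hστ⟩
    have hlt := Finset.card_lt_card hρσ
    have hlt' := Finset.card_lt_card hστ
    rw [ρ.2.2] at hlt
    rw [τ.2.2] at hlt'
    have hσ := (K.isRelLowerSet_faces τ.2.1).2 hστ.subset (Finset.card_pos.1 (by omega))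
    exact ⟨⟨σ, hσ, by omega⟩, ⟨hρσ.subset, hστ.subset⟩, rfl⟩

theorem sum_ite_between (ρ : Simplex K d) (τ : Simplex K (d + 2)) :
    (∑ σ : Simplex K (d + 1), if ρ.1 ⊆ σ.1 ∧ σ.1 ⊆ τ.1 then (1 : ZMod 2) else 0) = 0 := by
  rw [Finset.sum_boole]
  by_cases hρτ : ρ.1 ⊆ τ.1
  · rw [← Finset.card_map, map_filter_between_eq_Ioo, Finset.card_Ioo_finset hρτ, τ.2.2, ρ.2.2,
      Nat.add_sub_cancel_left]
    decide
  · rw [Finset.filter_false_of_mem fun σ _ h => hρτ (h.1.trans h.2), Finset.card_empty,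
      Nat.cast_zero]

theorem boundary_boundary (c : Chain K (d + 2)) : boundary K d (boundary K (d + 1) c) = 0 := by
  funext ρ
  calc boundary K d (boundary K (d + 1) c) ρ
    _ = ∑ σ : Simplex K (d + 1), ∑ τ : Simplex K (d + 2),
          (if ρ.1 ⊆ σ.1 ∧ σ.1 ⊆ τ.1 then 1 else 0) * c τ := by
        simp only [boundary_apply, Finset.ite_sum_zero, ite_and, ite_mul, one_mul, zero_mul]
    _ = ∑ τ : Simplex K (d + 2), (∑ σ : Simplex K (d + 1),
          if ρ.1 ⊆ σ.1 ∧ σ.1 ⊆ τ.1 then 1 else 0) * c τ := by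
        simp only [Finset.sum_mul]
        exact Finset.sum_comm
    _ = 0 := Finset.sum_eq_zero fun τ _ => by rw [sum_ite_between, zero_mul]

theorem boundary_single (τ : Simplex K (d + 1)) (σ : Simplex K d) :
    boundary K d (Pi.single τ 1) σ = if σ.1 ⊆ τ.1 then 1 else 0 := by
  rw [boundary_apply, Finset.sum_eq_single τ (fun τ' _ h => by simp [h]) (by simp),
    Pi.single_eq_same]

theorem span_range_boundary_single (d : ℕ) :
    Submodule.span (ZMod 2) (Set.range fun τ : Simplex K (d + 1) => boundary K d (Pi.single τ 1)) =
      LinearMap.range (boundary K d) := by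
  rw [LinearMap.range_eq_map, ← (Pi.basisFun (ZMod 2) (Simplex K (d + 1))).span_eq,
    Submodule.map_span, ← Set.range_comp]
  simp only [Function.comp_def, Pi.basisFun_apply]

end Boundary

/-! ### Shortest paths by relaxation -/

section Distance

variable {n : ℕ} {K : AbstractSimplicialComplex (Fin n)} (len : Simplex K 2 → ℕ)

theorem pathLength_cons {u v q : Fin n} (h : (oneSkeleton K).Adj u v)
    (w : (oneSkeleton K).Walk v q) :
    pathLength len (.cons h w) = len (edgeOfDart ⟨(u, v), h⟩) + pathLength len w := by
  simp [pathLength]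

theorem pathLength_bypass_le {p q : Fin n} (w : (oneSkeleton K).Walk p q) :
    pathLength len w.bypass ≤ pathLength len w :=
  (w.darts_bypass_sublist_darts.map _).sum_le_sum (by simp)

theorem edgeOfDart_symm (e : (oneSkeleton K).Dart) : edgeOfDart e.symm = edgeOfDart e :=
  Subtype.ext (Finset.pair_comm _ _)

theorem pathLength_reverse {p q : Fin n} (w : (oneSkeleton K).Walk p q) :
    pathLength len w.reverse = pathLength len w := by
  simp only [pathLength, SimpleGraph.Walk.darts_reverse, List.map_map, List.map_reverse,
    List.sum_reverse, Function.comp_def, edgeOfDart_symm]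

theorem pathLength_le_mul {len : Simplex K 2 → ℕ} {b : ℕ} (hb : ∀ e, len e ≤ b) {p q : Fin n}
    (w : (oneSkeleton K).Walk p q) : pathLength len w ≤ w.length * b := by
  induction w with
  | nil => simp [pathLength]
  | cons h w ih =>
    rw [pathLength_cons, SimpleGraph.Walk.length_cons, Nat.succ_mul, add_comm]
    exact add_le_add ih (hb _)

theorem exists_short_walk {p q : Fin n} (w : (oneSkeleton K).Walk p q) :
    ∃ w' : (oneSkeleton K).Walk q p, w'.length < n ∧ pathLength len w' ≤ pathLength len w := by
  refine ⟨w.bypass.reverse, ?_, (pathLength_reverse len _).trans_le (pathLength_bypass_le len w)⟩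
  simpa using w.bypass_isPath.length_lt

variable {len}

theorem geodist_le_coe_iff {p q : Fin n} {x : ℕ} :
    geodist len p q ≤ x ↔
      ∃ w : (oneSkeleton K).Walk q p, w.length < n ∧ pathLength len w ≤ x := by
  constructor
  · intro h
    obtain ⟨w, hw⟩ := iInf_lt_iff.1 (h.trans_lt (ENat.natCast_lt_natCast.2 x.lt_succ_self))
    obtain ⟨w', hlt, hle⟩ := exists_short_walk len w
    exact ⟨w', hlt, hle.trans (Nat.lt_succ_iff.1 (ENat.natCast_lt_natCast.1 hw))⟩
  · rintro ⟨w, -, hw⟩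
    refine (iInf_le _ w.reverse).trans ?_
    rw [pathLength_reverse]
    exact_mod_cast hw

theorem geodist_le_mul_of_ne_top {b : ℕ} (hb : ∀ e, len e ≤ b) {p q : Fin n}
    (h : geodist len p q ≠ ⊤) : geodist len p q ≤ (n * b : ℕ) := by
  lift geodist len p q to ℕ using h with x hx
  obtain ⟨w, hlt, -⟩ := geodist_le_coe_iff.1 hx.ge
  rw [hx]
  exact geodist_le_coe_iff.2
    ⟨w, hlt, (pathLength_le_mul hb w).trans (Nat.mul_le_mul_right b hlt.le)⟩

open Classical in
/-- The length of the edge between `u` and `v`, truncated at `top`, and `top` if they are not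
adjacent. -/
noncomputable def truncatedEdgeLength (len : Simplex K 2 → ℕ) (top : ℕ) (u v : Fin n) : ℕ :=
  if h : (oneSkeleton K).Adj u v then min top (len (edgeOfDart ⟨(u, v), h⟩)) else top

theorem truncatedEdgeLength_le_iff {top x : ℕ} {u v : Fin n} :
    truncatedEdgeLength len top u v ≤ x ↔
      top ≤ x ∨ ∃ h : (oneSkeleton K).Adj u v, len (edgeOfDart ⟨(u, v), h⟩) ≤ x := by
  rw [truncatedEdgeLength]
  split_ifs with h <;> simp [h]

/-- `D v` is the least length of a walk of at most `k` edges from `v` to `p`, truncated at `top`. -/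
def IsTruncatedDistance (len : Simplex K 2 → ℕ) (top k : ℕ) (p : Fin n) (D : Fin n → ℕ) : Prop :=
  ∀ v x, D v ≤ x ↔
    top ≤ x ∨ ∃ w : (oneSkeleton K).Walk v p, w.length ≤ k ∧ pathLength len w ≤ x

namespace IsTruncatedDistance

variable {top k : ℕ} {p : Fin n} {D : Fin n → ℕ}

theorem zero : IsTruncatedDistance len top 0 p fun v => if v = p then 0 else top := by
  intro v x
  beta_reduce
  split_ifs with h
  · subst h
    exact ⟨fun _ => .inr ⟨.nil, le_rfl, x.zero_le⟩, fun _ => x.zero_le⟩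
  · refine ⟨.inl, fun h' => h'.resolve_right ?_⟩
    rintro ⟨w, hw, -⟩
    exact h (SimpleGraph.Walk.eq_of_length_eq_zero (Nat.le_zero.1 hw))

theorem succ (h : IsTruncatedDistance len top k p D) {D' : Fin n → ℕ}
    (hD' : ∀ v x, D' v ≤ x ↔ D v ≤ x ∨ ∃ u, truncatedEdgeLength len top v u + D u ≤ x) :
    IsTruncatedDistance len top (k + 1) p D' := by
  intro v x
  rw [hD', h]
  constructor
  · rintro ((hx | ⟨w, hwk, hwx⟩) | ⟨u, hu⟩)
    · exact .inl hx
    · exact .inr ⟨w, hwk.trans k.le_succ, hwx⟩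
    · obtain htop | ⟨w, hwk, hwx⟩ := (h u (D u)).1 le_rfl
      · exact .inl (by omega)
      obtain htop | ⟨hadj, hlen⟩ := truncatedEdgeLength_le_iff.1
        (le_refl (truncatedEdgeLength len top v u))
      · exact .inl (by omega)
      · exact .inr ⟨.cons hadj w, Nat.succ_le_succ hwk, by rw [pathLength_cons]; omega⟩
  · rintro (hx | ⟨w, hwk, hwx⟩)
    · exact .inl (.inl hx)
    · cases w with
      | nil => exact .inl (.inr ⟨.nil, k.zero_le, hwx⟩)
      | @cons _ u _ hadj w =>
        rw [pathLength_cons] at hwx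
        have hDu := (h u (pathLength len w)).2 (.inr ⟨w, Nat.succ_le_succ_iff.1 hwk, le_rfl⟩)
        have hlen := truncatedEdgeLength_le_iff (len := len) (top := top).2 (.inr ⟨hadj, le_rfl⟩)
        exact .inr ⟨u, by omega⟩

theorem coe_eq (h : IsTruncatedDistance len top k p D) (hk : n ≤ k) (q : Fin n) :
    (D q : ℕ∞) = min ↑top (geodist len p q) := by
  refine eq_of_forall_ge_iff fun x => ?_
  induction x with
  | top => simp
  | coe x =>
    rw [Nat.cast_le, h, min_le_iff, Nat.cast_le, geodist_le_coe_iff]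
    refine or_congr_right ⟨fun ⟨w, _, hw⟩ => ?_, fun ⟨w, hlt, hw⟩ => ⟨w, hlt.le.trans hk, hw⟩⟩
    obtain ⟨w', hlt, hle⟩ := exists_short_walk len w.reverse
    exact ⟨w', hlt, hle.trans ((pathLength_reverse len w).trans_le hw)⟩

end IsTruncatedDistance

end Distance

/-! ### The encoded instance -/

theorem homologyClass_eq_iff {n d : ℕ} {K : AbstractSimplicialComplex (Fin n)}
    {z z' : Cycles K d} : homologyClass K z = homologyClass K z' ↔ z.1 - z'.1 ∈ Boundaries K d :=
  Submodule.Quotient.eq _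

theorem getD_flatMap {α β : Type*} {L : ℕ} {f : α → List β} (hf : ∀ a, (f a).length = L)
    (l : List α) {i j : ℕ} (hi : i < l.length) (hj : j < L) (b : β) :
    (l.flatMap f).getD (i * L + j) b = (f l[i]).getD j b := by
  induction l generalizing i with
  | nil => simp at hi
  | cons a l ih =>
    rw [List.flatMap_cons]
    cases i with
    | zero =>
      rw [Nat.zero_mul, zero_add, List.getD_append _ _ _ _ (by rwa [hf]), List.getElem_cons_zero]
    | succ i =>
      have hL : (i + 1) * L + j = L + (i * L + j) := by ring
      rw [List.getD_append_right _ _ _ _ (by rw [hf, hL]; exact Nat.le_add_right _ _), hf, hL,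
        Nat.add_sub_cancel_left, ih (Nat.lt_of_succ_lt_succ hi), List.getElem_cons_succ]

namespace Instance

variable (I : Instance)

/-- The length of the input word. -/
abbrev inputLength : ℕ := I.encode.length

/-- The `i`-th simplex, empty if there is none. -/
def face (i : ℕ) : Finset (Fin I.n) := (I.simplices.map Subtype.val).getD i ∅

/-- The vertices of the `i`-th simplex, as natural numbers. -/
def labels (i : ℕ) : Finset ℕ := (I.face i).map Fin.valEmbedding

open Classical in
/-- The value at the `i`-th simplex of a function on the simplices with `k` vertices, extended by
zero. -/
noncomputable def atIndex {M : Type} [Zero M] {k : ℕ} (f : Simplex I.K k → M) (i : ℕ) : M :=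
  if h : I.face i ∈ I.K.faces ∧ (I.face i).card = k then f ⟨I.face i, h⟩ else 0

variable {I} {M : Type} [Zero M] {k i : ℕ}

theorem face_of_lt (hi : i < I.simplices.length) : I.face i = (I.simplices[i]).1 := by
  simp [face, hi]

theorem face_of_le (hi : I.simplices.length ≤ i) : I.face i = ∅ := by
  simp [face, hi]

theorem face_mem_iff_nonempty : I.face i ∈ I.K.faces ↔ (I.face i).Nonempty := by
  refine ⟨fun h => (I.K.isRelLowerSet_faces h).1, fun h => ?_⟩
  obtain hi | hi := lt_or_ge i I.simplices.length
  · rw [face_of_lt hi]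
    exact (I.simplices[i]).2
  · simp [face_of_le hi] at h

theorem exists_face_eq {s : Finset (Fin I.n)} (hs : s ∈ I.K.faces) :
    ∃ i < I.simplices.length, I.face i = s := by
  obtain ⟨i, hi, h⟩ := List.getElem_of_mem (I.complete ⟨s, hs⟩)
  exact ⟨i, hi, by rw [face_of_lt hi, h]⟩

theorem exists_simplex_of_card_face (h : (I.face i).card = k + 1) :
    ∃ σ : Simplex I.K (k + 1), I.face i = σ.1 :=
  ⟨⟨I.face i, face_mem_iff_nonempty.2 (Finset.card_pos.1 (by omega)), h⟩, rfl⟩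

theorem atIndex_of_face_eq (f : Simplex I.K k → M) {σ : Simplex I.K k} (h : I.face i = σ.1) :
    I.atIndex f i = f σ := by
  obtain ⟨σ, hσ⟩ := σ
  subst h
  exact dif_pos hσ

theorem atIndex_of_card_ne (f : Simplex I.K k → M) (h : (I.face i).card ≠ k) :
    I.atIndex f i = 0 :=
  dif_neg fun h' => h h'.2

theorem atIndex_of_le (f : Simplex I.K k → M) (hi : I.simplices.length ≤ i) : I.atIndex f i = 0 :=
  dif_neg fun h => by simpa [face_of_le hi] using face_mem_iff_nonempty.1 h.1

theorem exists_of_atIndex_ne_zero {f : Simplex I.K k → M} (h : I.atIndex f i ≠ 0) :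
    ∃ σ : Simplex I.K k, I.face i = σ.1 ∧ f σ ≠ 0 := by
  rw [atIndex] at h
  split_ifs at h with hi
  · exact ⟨⟨I.face i, hi⟩, rfl, h⟩
  · exact absurd rfl h

theorem valueAt_getElem (f : Simplex I.K k → M) (hi : i < I.simplices.length) :
    valueAt f I.simplices[i] = I.atIndex f i := by
  obtain h | h := eq_or_ne (I.simplices[i]).1.card k
  · rw [valueAt, dif_pos h]
    exact (atIndex_of_face_eq f (face_of_lt hi)).symm
  · rw [valueAt, dif_neg h, atIndex_of_card_ne f (by rwa [face_of_lt hi])]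

theorem mem_labels_iff {v : ℕ} : v ∈ I.labels i ↔ ∃ q ∈ I.face i, q.1 = v := Finset.mem_map

theorem val_mem_labels_iff {q : Fin I.n} : q.1 ∈ I.labels i ↔ q ∈ I.face i :=
  Finset.mem_map' Fin.valEmbedding

theorem lt_of_mem_labels {v : ℕ} (h : v ∈ I.labels i) : i < I.simplices.length ∧ v < I.n := by
  obtain ⟨q, hq, rfl⟩ := mem_labels_iff.1 h
  exact ⟨not_le.1 fun hi => by simp [face_of_le hi] at hq, q.2⟩

theorem labels_subset_iff {j : ℕ} : I.labels i ⊆ I.labels j ↔ I.face i ⊆ I.face j :=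
  Finset.map_subset_map

theorem card_labels : (I.labels i).card = (I.face i).card := Finset.card_map _

theorem length_block (σ : {σ : Finset (Fin I.n) // σ ∈ I.K.faces}) :
    ((List.ofFn fun v : Fin I.n => if v ∈ σ.1 then 1 else 0) ++
      [valueAt I.len σ, (valueAt I.z₀.1 σ).val]).length = I.n + 2 := by
  simp

theorem inputLength_eq : I.inputLength = 3 + I.simplices.length * (I.n + 2) := by
  simp only [inputLength, encode, List.length_cons, List.length_flatMap, length_block,
    List.map_const', List.sum_replicate, smul_eq_mul]
  omega

theorem length_simplices_le : I.simplices.length ≤ I.inputLength := by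
  rw [inputLength_eq]
  nlinarith [Nat.zero_le (I.simplices.length * I.n)]

theorem n_le_inputLength : I.n ≤ I.inputLength := by
  obtain h | h := Nat.eq_zero_or_pos I.n
  · omega
  · have := List.length_pos_of_mem (I.complete ⟨_, I.K.singleton_mem ⟨0, h⟩⟩)
    rw [inputLength_eq]
    nlinarith

theorem inputLength_pos : 0 < I.inputLength := Nat.succ_pos _

theorem position_lt {j : ℕ} (hi : i < I.simplices.length) (hj : j < I.n + 2) :
    3 + i * (I.n + 2) + j < I.inputLength := by
  rw [inputLength_eq]
  nlinarith

theorem getD_encode {j : ℕ} (hi : i < I.simplices.length) (hj : j < I.n + 2) :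
    I.encode.getD (3 + i * (I.n + 2) + j) 0 =
      ((List.ofFn fun v : Fin I.n => if v ∈ I.face i then 1 else 0) ++
        [I.atIndex I.len i, (I.atIndex I.z₀.1 i).val]).getD j 0 := by
  rw [face_of_lt hi, ← valueAt_getElem _ hi, ← valueAt_getElem _ hi,
    ← getD_flatMap (L := I.n + 2) length_block I.simplices hi hj, add_assoc, add_comm 3]
  rfl

theorem getD_encode_incidence {v : ℕ} (hi : i < I.simplices.length) (hv : v < I.n) :
    I.encode.getD (3 + i * (I.n + 2) + v) 0 = if v ∈ I.labels i then 1 else 0 := by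
  rw [getD_encode hi (by omega), List.getD_append _ _ _ _ (by simpa using hv),
    List.getD_eq_getElem _ _ (by simpa using hv), List.getElem_ofFn]
  exact if_congr (val_mem_labels_iff (q := ⟨v, hv⟩)).symm rfl rfl

theorem getD_encode_len (hi : i < I.simplices.length) :
    I.encode.getD (3 + i * (I.n + 2) + I.n) 0 = I.atIndex I.len i := by
  rw [getD_encode hi (by omega), List.getD_append_right _ _ _ _ (by simp)]
  simp

theorem getD_encode_cycle (hi : i < I.simplices.length) :
    I.encode.getD (3 + i * (I.n + 2) + (I.n + 1)) 0 = (I.atIndex I.z₀.1 i).val := by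
  rw [getD_encode hi (by omega), List.getD_append_right _ _ _ _ (by simp)]
  simp

theorem len_le_sum_encode (e : Simplex I.K 2) :
    I.len e ≤ ∑ k ∈ Finset.range I.inputLength, I.encode.getD k 0 := by
  obtain ⟨i, hi, hie⟩ := exists_face_eq e.2.1
  rw [← atIndex_of_face_eq I.len hie, ← getD_encode_len hi]
  exact Finset.single_le_sum (f := fun k => I.encode.getD k 0) (fun _ _ => Nat.zero_le _)
    (Finset.mem_range.2 (position_lt hi (by omega)))

/-- The number that stands for infinity: it exceeds the length of every path that visits no vertex
twice. -/
def top (I : Instance) : ℕ :=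
  1 + I.inputLength * ∑ k ∈ Finset.range I.inputLength, I.encode.getD k 0

/-- Chains as vectors indexed by the positions of the simplices, extended by zero to all numbers
below the input length, which is the size of all tables. -/
noncomputable def chainVector (I : Instance) (k : ℕ) :
    Chain I.K k →ₗ[ZMod 2] (Fin I.inputLength → ZMod 2) where
  toFun c i := I.atIndex c i
  map_add' c c' := by
    funext i
    simp only [atIndex, Pi.add_apply]
    split_ifs <;> simp
  map_smul' a c := by
    funext i
    simp only [atIndex, Pi.smul_apply]
    split_ifs <;> simp

theorem chainVector_apply (c : Chain I.K k) (i : Fin I.inputLength) :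
    I.chainVector k c i = I.atIndex c i := rfl

/-- The boundaries as vectors. -/
noncomputable def boundaryVectors (I : Instance) :
    Submodule (ZMod 2) (Fin I.inputLength → ZMod 2) :=
  (Boundaries I.K I.d).map (I.chainVector (I.d + 1))

/-- The coefficient of the `j`-th simplex in the boundary of the `i`-th one, if they have the
dimensions `d` and `d + 1`, and `0` otherwise. -/
def boundaryEntry (I : Instance) (i j : ℕ) : ZMod 2 :=
  if (I.face i).card = I.d + 2 ∧ (I.face j).card = I.d + 1 ∧ I.face j ⊆ I.face i then 1 else 0

theorem boundaryEntry_eq_chainVector {τ : Simplex I.K (I.d + 2)} (hi : I.face i = τ.1) :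
    (fun j : Fin I.inputLength => I.boundaryEntry i j) =
      I.chainVector (I.d + 1) (boundary I.K (I.d + 1) (Pi.single τ 1)) := by
  funext j
  rw [chainVector_apply, boundaryEntry]
  by_cases hj : (I.face j).card = I.d + 1
  · obtain ⟨σ, hσ⟩ := exists_simplex_of_card_face hj
    rw [atIndex_of_face_eq _ hσ, boundary_single]
    simp [hσ, hi, τ.2.2, σ.2.2]
  · rw [atIndex_of_card_ne _ hj, if_neg fun h => hj h.2.1]

theorem span_range_boundaryEntry :
    Submodule.span (ZMod 2)
      (Set.range fun i j : Fin I.inputLength => I.boundaryEntry i j) = I.boundaryVectors := by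
  rw [boundaryVectors, Boundaries, ← span_range_boundary_single, Submodule.map_span,
    ← Set.range_comp]
  refine le_antisymm (Submodule.span_le.2 ?_) (Submodule.span_mono ?_)
  · rintro _ ⟨i, rfl⟩
    by_cases hi : (I.face i).card = I.d + 2
    · obtain ⟨τ, hτ⟩ := exists_simplex_of_card_face hi
      exact Submodule.subset_span ⟨τ, (boundaryEntry_eq_chainVector hτ).symm⟩
    · have hzero : (fun j : Fin I.inputLength => I.boundaryEntry i j) = 0 :=
        funext fun j => if_neg fun h => hi h.1
      exact (congrArg (· ∈ Submodule.span _ _) hzero).mpr (zero_mem _)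
  · rintro _ ⟨τ, rfl⟩
    obtain ⟨i, hi, hτ⟩ := exists_face_eq τ.2.1
    exact ⟨⟨i, hi.trans_le length_simplices_le⟩, boundaryEntry_eq_chainVector hτ⟩

theorem exists_homologous_cycle {z : Cycles I.K I.d} {y : Fin I.inputLength → ZMod 2}
    (hy : y - I.chainVector _ z.1 ∈ I.boundaryVectors) :
    ∃ z' : Cycles I.K I.d, homologyClass I.K z' = homologyClass I.K z ∧
      I.chainVector _ z'.1 = y := by
  obtain ⟨_, ⟨c, rfl⟩, hc⟩ := hy
  have hcycle : boundary I.K (I.d + 1) c ∈ Cycles I.K I.d := boundary_boundary c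
  refine ⟨z + ⟨_, hcycle⟩, homologyClass_eq_iff.2 ?_, ?_⟩
  · exact ⟨c, (add_sub_cancel_left z.1 _).symm⟩
  · exact (map_add _ _ _).trans (by rw [hc, add_sub_cancel])

theorem chainVector_sub_mem_boundaryVectors {z z' : Cycles I.K I.d}
    (h : homologyClass I.K z = homologyClass I.K z') :
    I.chainVector _ z.1 - I.chainVector _ z'.1 ∈ I.boundaryVectors := by
  rw [← map_sub]
  exact Submodule.mem_map_of_mem (homologyClass_eq_iff.1 h)

theorem mem_chainVertices_iff {c : Chain I.K k} {q : Fin I.n} :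
    q ∈ chainVertices c ↔ ∃ i, I.chainVector k c i ≠ 0 ∧ q ∈ I.face i := by
  constructor
  · rintro ⟨σ, hσ, hq⟩
    obtain ⟨i, hi, hiσ⟩ := exists_face_eq σ.2.1
    refine ⟨⟨i, hi.trans_le length_simplices_le⟩, ?_, by rwa [hiσ]⟩
    rwa [chainVector_apply, atIndex_of_face_eq c hiσ]
  · rintro ⟨i, hi, hq⟩
    obtain ⟨σ, hσ, hc⟩ := exists_of_atIndex_ne_zero hi
    exact ⟨σ, hc, by rwa [← hσ]⟩

end Instance

/-! ### Eccentricity and radius -/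

section Eccentricity

variable {n k d : ℕ} {K : AbstractSimplicialComplex (Fin n)} {len : Simplex K 2 → ℕ}

/-- The largest distance from `p` to a vertex of the chain, so that the radius is the least
eccentricity. -/
noncomputable def eccentricity (len : Simplex K 2 → ℕ) (p : Fin n) (c : Chain K k) : ℕ∞ :=
  ⨆ q ∈ chainVertices c, geodist len p q

theorem eccentricity_le_mul_of_ne_top {b : ℕ} (hb : ∀ e, len e ≤ b) {p : Fin n} {c : Chain K k}
    (h : eccentricity len p c ≠ ⊤) : eccentricity len p c ≤ (n * b : ℕ) :=
  iSup₂_le fun q hq => geodist_le_mul_of_ne_top hb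
    (ne_top_of_le_ne_top h (le_iSup₂ (f := fun q _ => geodist len p q) q hq))

section Truncated

variable {top R : ℕ} {p : Fin n} {c : Chain K k} {D : Fin n → ℕ}
  (hD : ∀ q, (D q : ℕ∞) = min ↑top (geodist len p q))

include hD

theorem coe_eq_min_eccentricity (hR : ∀ x, R ≤ x ↔ ∀ q ∈ chainVertices c, D q ≤ x) :
    (R : ℕ∞) = min ↑top (eccentricity len p c) := by
  refine eq_of_forall_ge_iff fun x => ?_
  induction x with
  | top => simp
  | coe x =>
    simp only [eccentricity, min_le_iff, iSup₂_le_iff, Nat.cast_le, hR]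
    simp only [← Nat.cast_le (α := ℕ∞), hD, min_le_iff]
    exact ⟨fun h => or_iff_not_imp_left.2 fun hx q hq => (h q hq).resolve_left hx,
      fun h q hq => h.imp_right fun h => h q hq⟩

theorem coe_le_eccentricity (hR : ∀ x, (∀ q ∈ chainVertices c, D q ≤ x) → R ≤ x) :
    (R : ℕ∞) ≤ eccentricity len p c := by
  generalize hx : eccentricity len p c = x
  induction x with
  | top => exact le_top
  | coe x =>
    refine Nat.cast_le.2 (hR x fun q hq => ?_)
    have hDx : (D q : ℕ∞) ≤ x :=
      ((hD q).trans_le (min_le_right _ _)).trans (hx ▸ le_iSup₂_of_le q hq le_rfl)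
    exact Nat.cast_le.1 hDx

end Truncated

/-- Distances may be truncated above the lengths of all walks without repeated vertices: a cycle is
of minimal radius if its truncated radius bounds all eccentricities from below. -/
theorem isMinRadiusCycle_of_le {b top : ℕ} (hb : ∀ e, len e ≤ b) (htop : n * b < top)
    {z₀ z : Cycles K d} (hz : homologyClass K z = homologyClass K z₀) {R : ℕ}
    (hR : min ↑top (radius len z.1) ≤ R)
    (hmin : ∀ p, ∀ z' : Cycles K d, homologyClass K z' = homologyClass K z₀ →
      (R : ℕ∞) ≤ eccentricity len p z'.1) :
    IsMinRadiusCycle len (homologyClass K z₀) z := by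
  refine ⟨hz, fun z' hz' => le_iInf fun p => ?_⟩
  change radius len z.1 ≤ eccentricity len p z'.1
  obtain h | h := eq_or_ne (eccentricity len p z'.1) ⊤
  · exact h.symm ▸ le_top
  have hRb := (hmin p z' hz').trans (eccentricity_le_mul_of_ne_top hb h)
  obtain h' | h' := min_le_iff.1 hR
  · exact absurd (Nat.cast_le.1 (h'.trans hRb)) htop.not_ge
  · exact h'.trans (hmin p z' hz')

end Eccentricity

open RAM RAM.Expr Instance

/-! ### The algorithm -/

/-- The tables of the algorithm. Those that depend on one index use column `0`, and those without
index use the entry `(0, 0)`. -/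
inductive Table where
  | incidence | simplexLength | cycle | card | infinity | edgeLength | boundaryMatrix
  | distance | weight | rows | reduced | treated | priority | pivotColumn | pivotRow
  | cycleRadius | bestRadius | bestCycle
  deriving DecidableEq, Encodable

/-- The number of vertices. -/
def numVertices : Expr Table := .input (.const 0)

/-- The dimension of the cycle. -/
def dimension : Expr Table := .input (.const 1)

/-- The number of simplices. -/
def numSimplices : Expr Table := .input (.const 2)

/-- The position in the input of the description of the simplex with the number `var 0`. -/
def position : Expr Table :=
  .add (.const 3) (sum (.ite (lt (.var 0) (.var 2)) (.add numVertices (.const 2)) (.const 0)))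

/-- The incidence of the simplex `var 0` with the vertex `var 1`. -/
def incidenceEntry : Expr Table :=
  .ite (Expr.and (lt (.var 0) numSimplices) (lt (.var 1) numVertices))
    (.input (.add position (.var 1))) (.const 0)

/-- The length of the simplex `var 0`, and `0` if it is not an edge. -/
def simplexLengthEntry : Expr Table :=
  .ite (lt (.var 0) numSimplices) (.input (.add position numVertices)) (.const 0)

/-- The coefficient of the simplex `var 0` in the given cycle. -/
def cycleEntry : Expr Table :=
  .ite (lt (.var 0) numSimplices) (.input (.add position (.add numVertices (.const 1)))) (.const 0)

/-- The number of vertices of the simplex `var 0`. -/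
def cardEntry : Expr Table := sum (.load .incidence (.var 2) (.var 0))

/-- The number `Instance.top`; the product in its definition is an iterated sum. -/
def infinityEntry : Expr Table := .add (.const 1) (sum (sum (.input (.var 0))))

/-- The truncated length of the edge between the vertices `var 0` and `var 1`. -/
def edgeLengthEntry : Expr Table :=
  minimum (load₀ .infinity) <|
    .ite (Expr.ne (load₁ .card (.var 0)) (.const 2)) (load₀ .infinity) <|
    .ite (Expr.and (Expr.ne (.var 2) (.var 3))
        (Expr.and (.load .incidence (.var 0) (.var 2)) (.load .incidence (.var 0) (.var 3))))
      (load₁ .simplexLength (.var 0)) (load₀ .infinity)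

/-- The coefficient of the simplex `var 1` in the boundary of the simplex `var 0`. -/
def boundaryMatrixEntry : Expr Table :=
  .ite (.add (Expr.ne (load₁ .card (.var 0)) (.add dimension (.const 2))) <|
      .add (Expr.ne (load₁ .card (.var 1)) (.add dimension (.const 1))) <|
      maximum (.sub (.load .incidence (.var 3) (.var 0)) (.load .incidence (.var 2) (.var 0))))
    (.const 0) (.const 1)

/-- Extract the complex and the cycle from the input. -/
def loadInput : Cmd Table :=
  .seq (.assign .incidence incidenceEntry) <|
  .seq (.assign .simplexLength simplexLengthEntry) <|
  .seq (.assign .cycle cycleEntry) <|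
  .seq (.assign .card cardEntry) (.assign .infinity infinityEntry)

/-- Fill in the tables that depend on the input only, and start with the given cycle. -/
def prepare : Cmd Table :=
  .seq loadInput <|
  .seq (.assign .edgeLength edgeLengthEntry) <|
  .seq (.assign .boundaryMatrix boundaryMatrixEntry) <|
  .seq (.assign .bestRadius (load₀ .infinity)) (.assign .bestCycle (load₁ .cycle (.var 0)))

/-- One round of relaxation of the distances. -/
def relax : Cmd Table :=
  .assign .distance <| minimum (load₁ .distance (.var 0)) <|
    .add (.load .edgeLength (.var 2) (.var 0)) (load₁ .distance (.var 0))

/-- Compute the distances from the center `var 0`. -/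
def distances : Cmd Table :=
  .seq (.assign .distance (.ite (Expr.ne (.var 0) (.var 2)) (load₀ .infinity) (.const 0)))
    (.loop relax)

/-- Select a coordinate of largest weight among those that have not been treated. -/
def selectColumn : Cmd Table :=
  .seq (.assign .priority
    (.ite (load₁ .treated (.var 0)) (.const 0) (.add (load₁ .weight (.var 0)) (.const 1))))
  (.assign .pivotColumn (argmax .priority (.const 0)))

/-- Select a row that does not vanish at the selected coordinate, if there is one. -/
def selectRow : Cmd Table := .assign .pivotRow (argmax .rows (load₀ .pivotColumn))

/-- The value after clearing the selected coordinate, if the value before is `y`, the value at the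
selected coordinate is `yPivot` and the value of the pivot row is `p`. -/
def clearedEntry (y yPivot p : Expr Table) : Expr Table :=
  Expr.xor y (Expr.and (Expr.and (.load .rows (load₀ .pivotRow) (load₀ .pivotColumn)) yPivot) p)

/-- Clear the selected coordinate in all rows and in the reduced vector. -/
def clearPivot : Cmd Table :=
  .seq (.assign .reduced <| clearedEntry (load₁ .reduced (.var 0))
    (load₁ .reduced (load₀ .pivotColumn)) (.load .rows (load₀ .pivotRow) (.var 0)))
  (.assign .rows <| clearedEntry (.load .rows (.var 0) (.var 1))
    (.load .rows (.var 0) (load₀ .pivotColumn)) (.load .rows (load₀ .pivotRow) (.var 1)))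

/-- Record that the selected coordinate has been treated. -/
def markTreated : Cmd Table :=
  .assign .treated (.ite (Expr.ne (.var 0) (load₀ .pivotColumn)) (load₁ .treated (.var 0))
    (.const 1))

/-- One round of the elimination. -/
def eliminate : Cmd Table := .seq selectColumn <| .seq selectRow <| .seq clearPivot markTreated

/-- The weight of a simplex is the largest distance of one of its vertices; start the elimination
with the given cycle. -/
def startElimination : Cmd Table :=
  .seq (.assign .weight
    (maximum (.ite (.load .incidence (.var 2) (.var 0)) (load₁ .distance (.var 0)) (.const 0)))) <|
  .seq (.assign .rows (.load .boundaryMatrix (.var 0) (.var 1))) <|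
  .seq (.assign .reduced (load₁ .cycle (.var 0))) (.assign .treated (.const 0))

/-- The largest weight of a coordinate at which the reduced vector does not vanish. -/
def reducedWeight : Expr Table :=
  maximum (.ite (load₁ .reduced (.var 0)) (load₁ .weight (.var 0)) (.const 0))

/-- Compute a homologous cycle of least eccentricity for the given distances. -/
def reduce : Cmd Table :=
  .seq startElimination <| .seq (.loop eliminate) (.assign .cycleRadius reducedWeight)

/-- Nonzero if `var 2` is a vertex and its cycle is better than those of the previous vertices. -/
def improves : Expr Table :=
  Expr.and (lt (.var 2) numVertices) (lt (load₀ .cycleRadius) (load₀ .bestRadius))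

/-- Keep the cycle for the center `var 0` if it is better than the previous ones. -/
def keepBest : Cmd Table :=
  .seq (.assign .bestCycle (.ite improves (.ite (load₁ .reduced (.var 0)) (.const 1) (.const 0))
    (load₁ .bestCycle (.var 0))))
  (.assign .bestRadius (.ite improves (load₀ .cycleRadius) (load₀ .bestRadius)))

/-- Try the center `var 0`. -/
def tryCenter : Cmd Table := .seq distances (.seq reduce keepBest)

/-- The whole algorithm. -/
def minRadiusCycle : Cmd Table := .seq prepare (.loop tryCenter)

/-! ### The entries of the tables -/

section Entries

variable {I : Instance} {σ : Tables Table} {env : List ℕ} {i : ℕ}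

theorem eval_position (hi : i ≤ I.inputLength) :
    position.eval I.encode σ (i :: env) = 3 + i * (I.n + 2) := by
  have hsum := eval_sum (e := .ite (lt (.var 0) (.var 2)) (.add numVertices (.const 2)) (.const 0))
    (w := I.encode) (σ := σ) (env := i :: env) (f := fun k => if k < i then I.n + 2 else 0)
    fun k _ x => eval_ite (P := k < i) eval_lt_ne_zero
  have hfilter : (Finset.range I.inputLength).filter (· < i) = Finset.range i := by
    ext k
    simp only [Finset.mem_filter, Finset.mem_range]
    omega
  rw [← Finset.sum_filter, hfilter, Finset.sum_const, Finset.card_range, smul_eq_mul] at hsum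
  exact congrArg (3 + ·) hsum

theorem eval_incidenceEntry (v : ℕ) :
    incidenceEntry.eval I.encode σ (i :: v :: env) = if v ∈ I.labels i then 1 else 0 := by
  rw [incidenceEntry, eval_ite (P := i < I.simplices.length ∧ v < I.n)
    (eval_and_ne_zero.trans (and_congr eval_lt_ne_zero eval_lt_ne_zero))]
  by_cases h : i < I.simplices.length ∧ v < I.n
  · rw [if_pos h, ← getD_encode_incidence h.1 h.2,
      ← eval_position (σ := σ) (env := v :: env) (h.1.le.trans length_simplices_le)]
    rfl
  · rw [if_neg h, if_neg fun hv => h (lt_of_mem_labels hv)]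
    rfl

theorem eval_simplexLengthEntry :
    simplexLengthEntry.eval I.encode σ (i :: env) = I.atIndex I.len i := by
  rw [simplexLengthEntry, eval_ite (P := i < I.simplices.length) eval_lt_ne_zero]
  split_ifs with h
  · rw [← getD_encode_len h, ← eval_position (σ := σ) (env := env) (h.le.trans length_simplices_le)]
    rfl
  · exact (atIndex_of_le _ (not_lt.1 h)).symm

theorem eval_cycleEntry :
    cycleEntry.eval I.encode σ (i :: env) = (I.atIndex I.z₀.1 i).val := by
  rw [cycleEntry, eval_ite (P := i < I.simplices.length) eval_lt_ne_zero]
  split_ifs with h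
  · rw [← getD_encode_cycle h,
      ← eval_position (σ := σ) (env := env) (h.le.trans length_simplices_le)]
    rfl
  · rw [atIndex_of_le _ (not_lt.1 h)]
    rfl

theorem eval_infinityEntry : infinityEntry.eval I.encode σ env = I.top := by
  have hinner : ∀ env', (sum (.input (.var 0)) : Expr Table).eval I.encode σ env' =
      ∑ k ∈ Finset.range I.inputLength, I.encode.getD k 0 := fun _ => eval_sum fun _ _ _ => rfl
  have houter := eval_sum (env := env) fun k (_ : k < I.inputLength) x => hinner (k :: x :: env)
  rw [Finset.sum_const, Finset.card_range, smul_eq_mul] at houter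
  exact congrArg (1 + ·) houter

theorem eval_cardEntry (hinc : ∀ i v, σ .incidence i v = if v ∈ I.labels i then 1 else 0)
    (hi : i < I.inputLength) :
    cardEntry.eval I.encode σ (i :: env) = (I.face i).card := by
  rw [cardEntry,
    eval_sum fun k hk x => (eval_load (i := i) (j := k) rfl rfl hi hk).trans (hinc i k),
    Finset.sum_boole, Nat.cast_id, ← card_labels]
  congr 1
  ext v
  rw [Finset.mem_filter, Finset.mem_range]
  exact and_iff_right_of_imp fun hv => (lt_of_mem_labels hv).2.trans_le n_le_inputLength

theorem exists_edge_iff {u v : Fin I.n} {x : ℕ} :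
    (∃ k < I.inputLength, (I.face k).card = 2 ∧ u.1 ≠ v ∧ u.1 ∈ I.labels k ∧ v.1 ∈ I.labels k ∧
      I.atIndex I.len k ≤ x) ↔
    ∃ h : (oneSkeleton I.K).Adj u v, I.len (edgeOfDart ⟨(u, v), h⟩) ≤ x := by
  constructor
  · rintro ⟨k, -, hcard, huv, hu, hv, hx⟩
    rw [val_mem_labels_iff] at hu hv
    have huv' : u ≠ v := fun h => huv (congrArg _ h)
    have hface : {u, v} = I.face k := Finset.eq_of_subset_of_card_le
      (Finset.insert_subset hu (Finset.singleton_subset_iff.2 hv))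
      (hcard.trans (Finset.card_pair huv').symm).le
    have hadj : (oneSkeleton I.K).Adj u v :=
      ⟨huv', hface ▸ face_mem_iff_nonempty.2 ⟨u, hu⟩⟩
    refine ⟨hadj, ?_⟩
    rwa [← atIndex_of_face_eq (σ := edgeOfDart ⟨(u, v), hadj⟩) I.len hface.symm]
  · rintro ⟨h, hx⟩
    obtain ⟨k, hk, hface⟩ := exists_face_eq h.2
    refine ⟨k, hk.trans_le length_simplices_le, hface ▸ Finset.card_pair h.1,
      fun huv => h.1 (Fin.ext huv), ?_, ?_, ?_⟩
    · simp [val_mem_labels_iff, hface]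
    · simp [val_mem_labels_iff, hface]
    · rwa [atIndex_of_face_eq (σ := edgeOfDart ⟨(u, v), h⟩) I.len hface]

theorem eval_load_ne_zero (hinc : ∀ i v, σ .incidence i v = if v ∈ I.labels i then 1 else 0)
    {e₁ e₂ : Expr Table} {v : ℕ} (h₁ : e₁.eval I.encode σ env = i)
    (h₂ : e₂.eval I.encode σ env = v) (hi : i < I.inputLength) :
    (load .incidence e₁ e₂).eval I.encode σ env ≠ 0 ↔ v ∈ I.labels i := by
  subst h₁ h₂
  rw [eval]
  split_ifs with h
  · simp [hinc]
  · exact iff_of_false (by simp) fun hv =>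
      h ⟨hi, (lt_of_mem_labels hv).2.trans_le n_le_inputLength⟩

theorem eval_edgeLengthEntry_le_iff
    (hinc : ∀ i v, σ .incidence i v = if v ∈ I.labels i then 1 else 0)
    (hcard : ∀ i < I.inputLength, σ .card i 0 = (I.face i).card)
    (hlen : ∀ i, σ .simplexLength i 0 = I.atIndex I.len i) (hinf : σ .infinity 0 0 = I.top)
    {u v x : ℕ} :
    edgeLengthEntry.eval I.encode σ (u :: v :: env) ≤ x ↔ I.top ≤ x ∨
      ∃ k < I.inputLength, (I.face k).card = 2 ∧ u ≠ v ∧ u ∈ I.labels k ∧ v ∈ I.labels k ∧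
        I.atIndex I.len k ≤ x := by
  have hinf' : ∀ env', (load₀ Table.infinity).eval I.encode σ env' = I.top := fun _ =>
    (eval_load₀ inputLength_pos).trans hinf
  rw [edgeLengthEntry, eval_minimum_le_iff (f := fun k => if (I.face k).card ≠ 2 then I.top else
    if u ≠ v ∧ u ∈ I.labels k ∧ v ∈ I.labels k then I.atIndex I.len k else I.top), hinf']
  · refine or_congr_right' fun hx => exists_congr fun k => and_congr_right fun _ => ?_
    split_ifs with h₁ h₂ <;> tauto
  · intro k hk y
    rw [eval_ite (eval_ne_ne_zero (e₂ := .const 2).trans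
      (by rw [eval_load₁ (i := k) rfl hk, hcard k hk])),
      eval_ite (eval_and_ne_zero.trans (and_congr eval_ne_ne_zero (eval_and_ne_zero.trans (and_congr
        (eval_load_ne_zero (i := k) hinc rfl rfl hk)
        (eval_load_ne_zero (i := k) hinc rfl rfl hk))))),
      eval_load₁ (i := k) rfl hk, hlen, hinf']
    rfl

theorem toZMod2_eval_boundaryMatrixEntry
    (hinc : ∀ i v, σ .incidence i v = if v ∈ I.labels i then 1 else 0)
    (hcard : ∀ i < I.inputLength, σ .card i 0 = (I.face i).card) {j : ℕ}
    (hi : i < I.inputLength) (hj : j < I.inputLength) :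
    toZMod2 (boundaryMatrixEntry.eval I.encode σ (i :: j :: env)) = I.boundaryEntry i j := by
  have hne : ∀ {k l}, k < I.inputLength → ∀ {e₁ e₂ : Expr Table},
      e₁.eval I.encode σ (i :: j :: env) = k → e₂.eval I.encode σ (i :: j :: env) = l →
      ((Expr.ne (load₁ .card e₁) e₂).eval I.encode σ (i :: j :: env) = 0 ↔
        (I.face k).card = l) := fun hk _ _ h₁ h₂ => by
    rw [← not_iff_not, ← ne_eq, eval_ne_ne_zero, eval_load₁ h₁ hk, hcard _ hk, h₂]
  have hsubset : (maximum (.sub (.load .incidence (.var 3) (.var 0))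
      (.load .incidence (.var 2) (.var 0)))).eval I.encode σ (i :: j :: env) = 0 ↔
      I.face j ⊆ I.face i := by
    rw [← Nat.le_zero, eval_maximum_le_iff (f := fun k => σ .incidence j k - σ .incidence i k)
      fun k hk x => congrArg₂ _ (eval_load (i := j) (j := k) rfl rfl hj hk)
        (eval_load (i := i) (j := k) rfl rfl hi hk),
      ← labels_subset_iff]
    simp only [hinc]
    refine ⟨fun h k hk => ?_, fun h k _ => ?_⟩
    · have := h k ((lt_of_mem_labels hk).2.trans_le n_le_inputLength)
      by_contra hk'
      simp [hk, hk'] at this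
    · by_cases hk : k ∈ I.labels j <;> simp [hk, fun hk => h hk]
  rw [boundaryMatrixEntry, eval_ite (P := ¬((I.face i).card = I.d + 2 ∧
    (I.face j).card = I.d + 1 ∧ I.face j ⊆ I.face i)), boundaryEntry]
  · split_ifs <;> simp_all [toZMod2, eval]
  · change ¬ (_ + (_ + _) = 0) ↔ _
    rw [Nat.add_eq_zero_iff, Nat.add_eq_zero_iff, hsubset, hne hi rfl rfl, hne hj rfl rfl]
    rfl

end Entries

/-! ### The distances from a center -/

/-- The tables that depend on the input only have been filled in. -/
structure Prepared (I : Instance) (σ : Tables Table) : Prop where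
  incidence : ∀ i v, σ .incidence i v = if v ∈ I.labels i then 1 else 0
  cycle : ∀ i, σ .cycle i 0 = (I.atIndex I.z₀.1 i).val
  infinity : σ .infinity 0 0 = I.top
  edgeLength_le_iff : ∀ u v x, σ .edgeLength u v ≤ x ↔ I.top ≤ x ∨
    ∃ k < I.inputLength, (I.face k).card = 2 ∧ u ≠ v ∧ u ∈ I.labels k ∧ v ∈ I.labels k ∧
      I.atIndex I.len k ≤ x
  boundaryMatrix : ∀ i < I.inputLength, ∀ j < I.inputLength,
    toZMod2 (σ .boundaryMatrix i j) = I.boundaryEntry i j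

variable {I : Instance} {σ : Tables Table} {env : List ℕ}

theorem prepared_exec_prepare : Prepared I (prepare.exec I.encode env σ) := by
  let σ' := loadInput.exec I.encode env σ
  have hinc : ∀ i v, σ' .incidence i v = if v ∈ I.labels i then 1 else 0 := fun _ v =>
    eval_incidenceEntry v
  have hcard : ∀ i < I.inputLength, σ' .card i 0 = (I.face i).card := fun _ =>
    eval_cardEntry fun _ v => eval_incidenceEntry v
  have hlen : ∀ i, σ' .simplexLength i 0 = I.atIndex I.len i := fun _ => eval_simplexLengthEntry
  have hinf : σ' .infinity 0 0 = I.top := eval_infinityEntry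
  let σ'' := (Cmd.assign .edgeLength edgeLengthEntry).exec I.encode env σ'
  have hbm : ∀ i < I.inputLength, ∀ j < I.inputLength,
      toZMod2 (boundaryMatrixEntry.eval I.encode σ'' (i :: j :: env)) = I.boundaryEntry i j :=
    fun i hi j hj => toZMod2_eval_boundaryMatrixEntry (σ := σ'') hinc hcard hi hj
  constructor
  · exact hinc
  · exact fun _ => eval_cycleEntry
  · exact hinf
  · exact fun _ _ _ => eval_edgeLengthEntry_le_iff hinc hcard hlen hinf
  · simp only [prepare, Cmd.exec, Function.update_apply, reduceCtorEq, if_true, if_false]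
    exact hbm

theorem Prepared.exec (h : Prepared I σ) (c : Cmd Table)
    (hc : ∀ a ∈ [Table.incidence, .cycle, .infinity, .edgeLength, .boundaryMatrix],
      a ∉ c.writes) : Prepared I (c.exec I.encode env σ) := by
  have heq : ∀ a ∈ _, c.exec I.encode env σ a = σ a := fun a ha => c.exec_of_notMem_writes (hc a ha)
  constructor
  · rw [heq .incidence (by decide)]
    exact h.incidence
  · rw [heq .cycle (by decide)]
    exact h.cycle
  · rw [heq .infinity (by decide)]
    exact h.infinity
  · rw [heq .edgeLength (by decide)]
    exact h.edgeLength_le_iff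
  · rw [heq .boundaryMatrix (by decide)]
    exact h.boundaryMatrix

theorem Prepared.edgeLength_eq (h : Prepared I σ) (u v : Fin I.n) :
    σ .edgeLength u v = truncatedEdgeLength I.len I.top u v :=
  eq_of_forall_ge_iff fun x => by
    rw [h.edgeLength_le_iff, exists_edge_iff, truncatedEdgeLength_le_iff]

theorem Prepared.top_le_edgeLength (h : Prepared I σ) {u v : ℕ} (hv : I.n ≤ v) :
    I.top ≤ σ .edgeLength u v := by
  obtain h' | ⟨k, -, -, -, -, hv', -⟩ := (h.edgeLength_le_iff u v _).1 le_rfl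
  · exact h'
  · exact absurd (lt_of_mem_labels hv').2 hv.not_gt

theorem Prepared.exec_relax (h : Prepared I σ) {k : ℕ} {p : Fin I.n}
    (hk : IsTruncatedDistance I.len I.top k p fun v => σ .distance v 0) :
    IsTruncatedDistance I.len I.top (k + 1) p fun v =>
      relax.exec I.encode env σ .distance v 0 := by
  refine hk.succ fun v x => ?_
  have hv := v.2.trans_le n_le_inputLength
  change (minimum _ _).eval I.encode σ (v.1 :: 0 :: env) ≤ x ↔ _
  rw [eval_minimum_le_iff (f := fun u => σ .edgeLength v u + σ .distance u 0)
    fun u hu _ => congrArg₂ _ (eval_load (i := v) (j := u) rfl rfl hv hu)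
      (eval_load₁ (i := u) rfl hu), eval_load₁ (i := v) rfl hv]
  refine or_congr_right' fun hx => ⟨?_, ?_⟩
  · rintro ⟨u, -, hux⟩
    obtain hu | hu := lt_or_ge u I.n
    · exact ⟨⟨u, hu⟩, by rwa [← h.edgeLength_eq v ⟨u, hu⟩]⟩
    · exact absurd ((hk v x).2 (.inl
        ((h.top_le_edgeLength hu).trans ((Nat.le_add_right _ _).trans hux)))) hx
  · rintro ⟨u, hu⟩
    exact ⟨u, u.2.trans_le n_le_inputLength, by rwa [h.edgeLength_eq]⟩

theorem Prepared.exec_distances (h : Prepared I σ) {p : Fin I.n} (q : Fin I.n) :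
    (distances.exec I.encode (p.1 :: env) σ .distance q 0 : ℕ∞) =
      min ↑I.top (geodist I.len p q) := by
  suffices hloop : Prepared I (distances.exec I.encode (p.1 :: env) σ) ∧
      IsTruncatedDistance I.len I.top I.inputLength p fun v =>
        distances.exec I.encode (p.1 :: env) σ .distance v 0 from
    hloop.2.coe_eq n_le_inputLength q
  refine fold_induction (fun k (σ' : Tables Table) => Prepared I σ' ∧
    IsTruncatedDistance I.len I.top k p fun v => σ' .distance v 0) ⟨?_, ?_⟩ ?_
  · exact h.exec (.assign .distance _) (by decide)
  · convert IsTruncatedDistance.zero (len := I.len) (top := I.top) (p := p) using 2 with v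
    refine (eval_ite (eval_ne_ne_zero (e₁ := .var 0) (e₂ := .var 2))).trans ?_
    rw [eval_load₀ inputLength_pos, h.infinity]
    exact (ite_not ..).trans (if_congr Fin.ext_iff.symm rfl rfl)
  · exact fun _ _ σ' ⟨hσ', hdist⟩ => ⟨hσ'.exec relax (by decide), hσ'.exec_relax hdist⟩

/-! ### Reducing the cycle -/

theorem clearAt_apply_zmod2 {κ : Type*} (p y : κ → ZMod 2) (s j : κ) :
    clearAt p s y j = y j + p s * y s * p j := by
  have hp : p s = 0 ∨ p s = 1 := by
    generalize p s = a
    revert a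
    decide
  rw [clearAt_apply, Pi.sub_apply, CharTwo.sub_eq_add]
  obtain h | h := hp <;> simp [h]

section Pivot

variable {w env : List ℕ} {σ : Tables Table}

/-- The contents of the table `rows` over `ZMod 2`, with one vector for each row. -/
def rowVectors (w : List ℕ) (σ : Tables Table) (i j : Fin w.length) : ZMod 2 :=
  toZMod2 (σ .rows i j)

/-- The contents of the table `reduced` as a vector over `ZMod 2`. -/
def reducedVector (w : List ℕ) (σ : Tables Table) (i : Fin w.length) : ZMod 2 :=
  toZMod2 (σ .reduced i 0)

/-- The coordinates that the elimination has treated. -/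
def treatedSet (w : List ℕ) (σ : Tables Table) : Set (Fin w.length) := {i | σ .treated i 0 ≠ 0}

theorem exists_exec_selectColumn (hw : 0 < w.length) :
    ∃ s : Fin w.length, selectColumn.exec w env σ .pivotColumn 0 0 = s ∧
      ∀ r ∉ treatedSet w σ, s ∉ treatedSet w σ ∧ σ .weight r 0 ≤ σ .weight s 0 := by
  let σ' := (Cmd.assign .priority (.ite (load₁ .treated (.var 0)) (.const 0)
    (.add (load₁ .weight (.var 0)) (.const 1)))).exec w env σ
  have hpriority : ∀ i : Fin w.length, σ' .priority i 0 =
      if σ .treated i 0 ≠ 0 then 0 else σ .weight i 0 + 1 := fun i =>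
    (eval_ite (by rw [eval_load₁ (i := i) rfl i.2])).trans
      (congrArg (_root_.ite _ 0 <| · + 1) (eval_load₁ (i := i) rfl i.2))
  obtain ⟨hs, hmax⟩ := eval_argmax (σ := σ') (env := 0 :: 0 :: env) (a := .priority)
    (e := .const 0) hw hw fun _ _ => rfl
  obtain ⟨s, hs⟩ : ∃ s : Fin w.length, selectColumn.exec w env σ .pivotColumn 0 0 = s :=
    ⟨⟨_, hs⟩, rfl⟩
  refine ⟨s, hs, fun r hr => ?_⟩
  have hle : σ' .priority r 0 ≤ σ' .priority s 0 := hs ▸ hmax r r.2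
  rw [hpriority, hpriority, if_neg (by exact hr)] at hle
  split_ifs at hle with hs'
  · exact absurd hle (Nat.not_succ_le_zero _)
  · exact ⟨hs', Nat.succ_le_succ_iff.1 hle⟩

theorem exists_exec_selectRow {s : Fin w.length} (hs : σ .pivotColumn 0 0 = s) :
    ∃ t : Fin w.length, selectRow.exec w env σ .pivotRow 0 0 = t ∧
      ∀ i, rowVectors w σ i s ≠ 0 → rowVectors w σ t s ≠ 0 := by
  obtain ⟨ht, hmax⟩ := eval_argmax (σ := σ) (env := 0 :: 0 :: env) (a := .rows)
    (e := load₀ .pivotColumn) s.pos s.2 fun _ _ => (eval_load₀ s.pos).trans hs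
  refine ⟨⟨_, ht⟩, rfl, fun i hi => toZMod2_ne_zero.2 ?_⟩
  exact ((Nat.pos_of_ne_zero (toZMod2_ne_zero.1 hi)).trans_le (hmax i i.2)).ne'

section Clear

variable {s t : Fin w.length} (hs : σ .pivotColumn 0 0 = s) (ht : σ .pivotRow 0 0 = t)

include hs

theorem treatedSet_exec_markTreated :
    treatedSet w (markTreated.exec w env σ) = insert s (treatedSet w σ) := by
  ext i
  have hi : markTreated.exec w env σ .treated i 0 = if i.1 ≠ s then σ .treated i 0 else 1 :=
    (eval_ite (eval_ne_ne_zero.trans (by rw [eval_load₀ s.pos, hs]))).trans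
      (by rw [eval_load₁ (i := i) rfl i.2]; rfl)
  rw [Set.mem_insert_iff, treatedSet, Set.mem_ofPred_eq, hi, Fin.ext_iff]
  split_ifs with h
  · exact (or_iff_right h).symm
  · exact iff_of_true one_ne_zero (.inl (not_not.1 h))

include ht

theorem toZMod2_eval_clearedEntry {y : Fin w.length → ZMod 2} {j : Fin w.length}
    {e e' p : Expr Table} (he : toZMod2 (e.eval w σ env) = y j)
    (he' : toZMod2 (e'.eval w σ env) = y s) (hp : p.eval w σ env = σ .rows t j) :
    toZMod2 ((clearedEntry e e' p).eval w σ env) = clearAt (rowVectors w σ t) s y j := by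
  have hts : (load .rows (load₀ .pivotRow) (load₀ .pivotColumn)).eval w σ env = σ .rows t s :=
    eval_load ((eval_load₀ s.pos).trans ht) ((eval_load₀ s.pos).trans hs) t.2 s.2
  rw [clearedEntry, toZMod2_eval_xor, toZMod2_eval_and, toZMod2_eval_and, he, he', hp, hts,
    clearAt_apply_zmod2]
  rfl

theorem reducedVector_exec_clearPivot :
    reducedVector w (clearPivot.exec w env σ) =
      clearAt (rowVectors w σ t) s (reducedVector w σ) :=
  funext fun j => toZMod2_eval_clearedEntry hs ht
    (congrArg toZMod2 (eval_load₁ (i := j) rfl j.2))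
    (congrArg toZMod2 (eval_load₁ ((eval_load₀ s.pos).trans hs) s.2))
    (eval_load (j := j) ((eval_load₀ s.pos).trans ht) rfl t.2 j.2)

theorem rowVectors_exec_clearPivot :
    rowVectors w (clearPivot.exec w env σ) =
      fun i => clearAt (rowVectors w σ t) s (rowVectors w σ i) := by
  let c : Cmd Table := .assign .reduced <| clearedEntry (load₁ .reduced (.var 0))
    (load₁ .reduced (load₀ .pivotColumn)) (.load .rows (load₀ .pivotRow) (.var 0))
  exact funext₂ fun i j => toZMod2_eval_clearedEntry (σ := c.exec w env σ) hs ht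
    (congrArg toZMod2 (eval_load (i := i) (j := j) rfl rfl i.2 j.2))
    (congrArg toZMod2 (eval_load (i := i) rfl ((eval_load₀ s.pos).trans hs) i.2 s.2))
    (eval_load (j := j) ((eval_load₀ s.pos).trans ht) rfl t.2 j.2)

end Clear

/-- The tables contain the state of an elimination with at least `k` treated coordinates. -/
def Eliminated (w : List ℕ) (B : Submodule (ZMod 2) (Fin w.length → ZMod 2))
    (z₀ : Fin w.length → ZMod 2) (k : ℕ) (σ : Tables Table) : Prop :=
  k ≤ (treatedSet w σ).ncard ∧ EliminationState B z₀ (fun i : Fin w.length => σ .weight i 0)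
    (rowVectors w σ) (reducedVector w σ) (treatedSet w σ)

variable {B : Submodule (ZMod 2) (Fin w.length → ZMod 2)} {z₀ : Fin w.length → ZMod 2}

theorem Eliminated.exec_eliminate {k : ℕ} (hk : k < w.length) (h : Eliminated w B z₀ k σ) :
    Eliminated w B z₀ (k + 1) (eliminate.exec w env σ) := by
  obtain ⟨s, hs, hmax⟩ := exists_exec_selectColumn (env := env) (σ := σ) (k.zero_le.trans_lt hk)
  obtain ⟨t, ht, hrow⟩ := exists_exec_selectRow (env := env) hs
  have hW : eliminate.exec w env σ .weight = σ .weight :=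
    Cmd.exec_of_notMem_writes _ (by decide)
  have hstep := h.2.step (fun r hr _ => (hmax r hr).2) hrow
  have htreated : treatedSet w (eliminate.exec w env σ) = insert s (treatedSet w σ) :=
    treatedSet_exec_markTreated hs
  have hreduced : reducedVector w (eliminate.exec w env σ) =
      clearAt (rowVectors w σ t) s (reducedVector w σ) := reducedVector_exec_clearPivot hs ht
  have hrows : rowVectors w (eliminate.exec w env σ) =
      fun i => clearAt (rowVectors w σ t) s (rowVectors w σ i) := rowVectors_exec_clearPivot hs ht
  refine ⟨?_, by rwa [htreated, hreduced, hrows, hW]⟩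
  rw [htreated]
  by_cases hsΔ : s ∈ treatedSet w σ
  · have huniv : treatedSet w σ = Set.univ :=
      Set.eq_univ_of_forall fun r => by_contra fun hr => (hmax r hr).1 hsΔ
    rwa [Set.insert_eq_of_mem hsΔ, huniv, Set.ncard_univ, Nat.card_fin]
  · rw [Set.ncard_insert_of_notMem hsΔ]
    exact Nat.succ_le_succ h.1

theorem exec_loop_eliminate (h : Eliminated w B z₀ 0 σ) :
    Eliminated w B z₀ w.length ((Cmd.loop eliminate).exec w env σ) :=
  fold_induction (Eliminated w B z₀) h fun _ hk _ => Eliminated.exec_eliminate hk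

theorem Eliminated.exists_weight_le (h : Eliminated w B z₀ w.length σ)
    {z : Fin w.length → ZMod 2} (hz : z - z₀ ∈ B) {r : Fin w.length}
    (hr : reducedVector w σ r ≠ 0) :
    ∃ s, z s ≠ 0 ∧ σ .weight r 0 ≤ σ .weight s 0 := by
  have huniv : treatedSet w σ = Set.univ :=
    Set.eq_of_subset_of_ncard_le (Set.subset_univ _) (by simpa [Set.ncard_univ] using h.1)
  exact h.2.exists_weight_le (fun _ _ _ _ => huniv ▸ Set.mem_univ _) hz hr

end Pivot

section Reduce

variable {I : Instance} {σ : Tables Table} {env : List ℕ}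

theorem Prepared.eliminated_exec_startElimination (h : Prepared I σ) :
    Eliminated I.encode I.boundaryVectors (I.chainVector _ I.z₀.1) 0
      (startElimination.exec I.encode env σ) := by
  have hrows : rowVectors I.encode (startElimination.exec I.encode env σ) =
      fun i j : Fin I.inputLength => I.boundaryEntry i j := funext₂ fun i j =>
    (congrArg toZMod2 (eval_load (i := i) (j := j) rfl rfl i.2 j.2)).trans
      (h.boundaryMatrix i i.2 j j.2)
  have hreduced : reducedVector I.encode (startElimination.exec I.encode env σ) =
      I.chainVector _ I.z₀.1 := funext fun i => by
    have hi : startElimination.exec I.encode env σ .reduced i 0 = (I.atIndex I.z₀.1 i).val :=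
      (eval_load₁ (i := i) rfl i.2).trans (h.cycle i)
    exact (congrArg toZMod2 hi).trans (toZMod2_val _)
  have htreated : treatedSet I.encode (startElimination.exec I.encode env σ) = ∅ :=
    Set.eq_empty_of_forall_notMem fun i hi => hi rfl
  refine ⟨Nat.zero_le _, ?_⟩
  rw [hrows, hreduced, htreated]
  exact .initial span_range_boundaryEntry

theorem Prepared.exec_startElimination_weight_le_iff (h : Prepared I σ) {i : ℕ}
    (hi : i < I.inputLength) {x : ℕ} :
    startElimination.exec I.encode env σ .weight i 0 ≤ x ↔
      ∀ q ∈ I.face i, σ .distance q 0 ≤ x := by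
  refine (eval_maximum_le_iff (f := fun v => if v ∈ I.labels i then σ .distance v 0 else 0)
    fun v hv y => ?_).trans ⟨fun hx q hq => ?_, fun hx v _ => ?_⟩
  · rw [eval_ite (eval_load_ne_zero (i := i) h.incidence rfl rfl hi), eval_load₁ (i := v) rfl hv]
    rfl
  · simpa [val_mem_labels_iff, hq] using hx q (q.2.trans_le n_le_inputLength)
  · split_ifs with hv
    · obtain ⟨q, hq, rfl⟩ := mem_labels_iff.1 hv
      exact hx q hq
    · exact Nat.zero_le x

theorem eval_reducedWeight_le_iff {w : List ℕ} {x : ℕ} :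
    reducedWeight.eval w σ env ≤ x ↔
      ∀ i : Fin w.length, reducedVector w σ i ≠ 0 → σ .weight i 0 ≤ x := by
  refine (eval_maximum_le_iff (f := fun i => if σ .reduced i 0 ≠ 0 then σ .weight i 0 else 0)
    fun i hi y => ?_).trans ⟨fun hx i hr => ?_, fun hx i hi => ?_⟩
  · rw [eval_ite (by rw [eval_load₁ (i := i) rfl hi]), eval_load₁ (i := i) rfl hi]
    rfl
  · simpa only [if_pos (toZMod2_ne_zero.1 hr)] using hx i i.2
  · split_ifs with hr
    · exact hx ⟨i, hi⟩ (toZMod2_ne_zero.2 hr)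
    · exact Nat.zero_le x

/-- The tables `reduced` and `cycleRadius` contain a cycle homologous to the given one and of least
eccentricity with respect to `p`, and its truncated eccentricity. -/
def HasLeastEccentricity (I : Instance) (p : Fin I.n) (σ : Tables Table) : Prop :=
  ∃ z : Cycles I.K I.d, homologyClass I.K z = homologyClass I.K I.z₀ ∧
    reducedVector I.encode σ = I.chainVector _ z.1 ∧
    (σ .cycleRadius 0 0 : ℕ∞) = min ↑I.top (eccentricity I.len p z.1) ∧
    ∀ z' : Cycles I.K I.d, homologyClass I.K z' = homologyClass I.K I.z₀ →
      (σ .cycleRadius 0 0 : ℕ∞) ≤ eccentricity I.len p z'.1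

theorem Prepared.hasLeastEccentricity_exec_reduce (h : Prepared I σ) {p : Fin I.n}
    (hD : ∀ q : Fin I.n, (σ .distance q 0 : ℕ∞) = min ↑I.top (geodist I.len p q)) :
    HasLeastEccentricity I p (reduce.exec I.encode env σ) := by
  let σ₁ := startElimination.exec I.encode env σ
  let σ₂ := (Cmd.loop eliminate).exec I.encode env σ₁
  have hσ₂ : Eliminated I.encode I.boundaryVectors (I.chainVector _ I.z₀.1) I.inputLength σ₂ :=
    exec_loop_eliminate h.eliminated_exec_startElimination
  obtain ⟨z, hz, hzσ₂⟩ := exists_homologous_cycle hσ₂.2.coset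
  have hW : σ₂ .weight = σ₁ .weight := Cmd.exec_of_notMem_writes _ (by decide)
  have hweight : ∀ i : Fin I.inputLength, ∀ x,
      σ₂ .weight i 0 ≤ x ↔ ∀ q ∈ I.face i, σ .distance q 0 ≤ x := fun i x => by
    rw [hW, h.exec_startElimination_weight_le_iff i.2]
  have hradius : ∀ x, reduce.exec I.encode env σ .cycleRadius 0 0 ≤ x ↔
      ∀ i, reducedVector I.encode σ₂ i ≠ 0 → σ₂ .weight i 0 ≤ x := fun x =>
    eval_reducedWeight_le_iff
  have hvertices : ∀ x, reduce.exec I.encode env σ .cycleRadius 0 0 ≤ x ↔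
      ∀ q ∈ chainVertices z.1, σ .distance q 0 ≤ x := fun x => by
    simp only [hradius, hweight, mem_chainVertices_iff, hzσ₂]
    exact ⟨fun h q ⟨i, hi, hq⟩ => h i hi q hq, fun h i hi q hq => h q ⟨i, hi, hq⟩⟩
  refine ⟨z, hz, hzσ₂.symm, coe_eq_min_eccentricity hD hvertices, fun z' hz' => ?_⟩
  refine coe_le_eccentricity hD fun x hx => (hradius x).2 fun r hr => ?_
  obtain ⟨s, hs, hle⟩ := hσ₂.exists_weight_le (chainVector_sub_mem_boundaryVectors hz') hr
  exact hle.trans ((hweight s x).2 fun q hq => hx q (mem_chainVertices_iff.2 ⟨s, hs, hq⟩))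

end Reduce

/-! ### The best center -/

/-- The cycle in the table is homologous to the given one, its truncated radius is at most the
number in the table, and that number is at most all eccentricities with respect to the first `m`
vertices. -/
structure BestSoFar (I : Instance) (m : ℕ) (σ : Tables Table) : Prop where
  exists_cycle : ∃ z : Cycles I.K I.d, homologyClass I.K z = homologyClass I.K I.z₀ ∧
    min ↑I.top (radius I.len z.1) ≤ σ .bestRadius 0 0 ∧
    ∀ i < I.inputLength, σ .bestCycle i 0 = (I.atIndex z.1 i).val
  le_eccentricity : ∀ p : Fin I.n, p < m → ∀ z' : Cycles I.K I.d,
    homologyClass I.K z' = homologyClass I.K I.z₀ →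
      (σ .bestRadius 0 0 : ℕ∞) ≤ eccentricity I.len p z'.1

variable {I : Instance} {σ : Tables Table} {env : List ℕ} {m : ℕ}

theorem bestSoFar_exec_prepare : BestSoFar I 0 (prepare.exec I.encode env σ) where
  exists_cycle := by
    let σ' := (Cmd.seq loadInput <| .seq (.assign .edgeLength edgeLengthEntry) <|
      .assign .boundaryMatrix boundaryMatrixEntry).exec I.encode env σ
    have hinfinity : σ' .infinity 0 0 = I.top := eval_infinityEntry
    have hradius : prepare.exec I.encode env σ .bestRadius 0 0 = I.top :=
      (eval_load₀ (σ := σ') inputLength_pos).trans hinfinity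
    refine ⟨I.z₀, rfl, hradius ▸ min_le_left _ _, fun i hi => ?_⟩
    exact (eval_load₁ (i := i) rfl hi).trans eval_cycleEntry
  le_eccentricity p hp := absurd hp (Nat.not_lt_zero p)

theorem eval_improves_ne_zero {i j : ℕ} :
    improves.eval I.encode σ (i :: j :: m :: env) ≠ 0 ↔
      m < I.n ∧ σ .cycleRadius 0 0 < σ .bestRadius 0 0 := by
  rw [improves, eval_and_ne_zero, eval_lt_ne_zero, eval_lt_ne_zero, eval_load₀ inputLength_pos,
    eval_load₀ inputLength_pos]
  rfl

theorem exec_keepBest_bestRadius :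
    keepBest.exec I.encode (m :: env) σ .bestRadius 0 0 =
      if m < I.n ∧ σ .cycleRadius 0 0 < σ .bestRadius 0 0 then σ .cycleRadius 0 0
      else σ .bestRadius 0 0 := by
  refine (eval_ite (eval_improves_ne_zero (σ := Function.update σ .bestCycle _))).trans ?_
  rw [eval_load₀ inputLength_pos, eval_load₀ inputLength_pos]
  rfl

theorem exec_keepBest_bestCycle (i : Fin I.inputLength) :
    keepBest.exec I.encode (m :: env) σ .bestCycle i 0 =
      if m < I.n ∧ σ .cycleRadius 0 0 < σ .bestRadius 0 0 then (reducedVector I.encode σ i).val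
      else σ .bestCycle i 0 := by
  refine (eval_ite eval_improves_ne_zero).trans (if_congr Iff.rfl ?_ ?_)
  · rw [reducedVector, val_toZMod2, eval_ite (by rw [eval_load₁ (i := i) rfl i.2])]
    rfl
  · exact eval_load₁ (i := i) rfl i.2

theorem BestSoFar.exec_keepBest (h : BestSoFar I m σ)
    (hσ : ∀ hm : m < I.n, HasLeastEccentricity I ⟨m, hm⟩ σ) :
    BestSoFar I (m + 1) (keepBest.exec I.encode (m :: env) σ) := by
  have hradius := exec_keepBest_bestRadius (I := I) (σ := σ) (env := env) (m := m)
  have hcycle := exec_keepBest_bestCycle (I := I) (σ := σ) (env := env) (m := m)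
  have hle : keepBest.exec I.encode (m :: env) σ .bestRadius 0 0 ≤ σ .bestRadius 0 0 :=
    hradius.trans_le (by split_ifs <;> omega)
  have hle' : m < I.n →
      keepBest.exec I.encode (m :: env) σ .bestRadius 0 0 ≤ σ .cycleRadius 0 0 := fun hm =>
    hradius.trans_le (by split_ifs <;> omega)
  constructor
  · split_ifs at hradius hcycle with himproves
    · obtain ⟨z, hz, hzσ, hzradius, -⟩ := hσ himproves.1
      refine ⟨z, hz, ?_, fun i hi => ?_⟩
      · exact hradius ▸ hzradius ▸ min_le_min_left _ (iInf_le _ _)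
      · exact (hcycle ⟨i, hi⟩).trans (congrArg ZMod.val (congrFun hzσ _))
    · obtain ⟨z, hz, hzradius, hzσ⟩ := h.exists_cycle
      exact ⟨z, hz, hradius ▸ hzradius, fun i hi => (hcycle ⟨i, hi⟩).trans (hzσ i hi)⟩
  · intro p hp z' hz'
    obtain hp | rfl := Nat.lt_succ_iff_lt_or_eq.1 hp
    · exact (Nat.cast_le.2 hle).trans (h.le_eccentricity p hp z' hz')
    · obtain ⟨-, -, -, -, hmin⟩ := hσ p.2
      exact (Nat.cast_le.2 (hle' p.2)).trans (hmin z' hz')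

theorem BestSoFar.exec (h : BestSoFar I m σ) (c : Cmd Table)
    (hc : ∀ a ∈ [Table.bestRadius, .bestCycle], a ∉ c.writes) :
    BestSoFar I m (c.exec I.encode env σ) := by
  have heq : ∀ a ∈ _, c.exec I.encode env σ a = σ a := fun a ha => c.exec_of_notMem_writes (hc a ha)
  constructor
  · rw [heq .bestRadius (by decide), heq .bestCycle (by decide)]
    exact h.exists_cycle
  · rw [heq .bestRadius (by decide)]
    exact h.le_eccentricity

theorem BestSoFar.exec_tryCenter (h : BestSoFar I m σ) (hσ : Prepared I σ) :
    BestSoFar I (m + 1) (tryCenter.exec I.encode (m :: env) σ) :=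
  (h.exec (.seq distances reduce) (by decide)).exec_keepBest fun hm =>
    (hσ.exec distances (by decide)).hasLeastEccentricity_exec_reduce
      (hσ.exec_distances (p := ⟨m, hm⟩))

theorem BestSoFar.exists_isMinRadiusCycle (h : BestSoFar I I.inputLength σ) :
    ∃ z : Cycles I.K I.d, IsMinRadiusCycle I.len (homologyClass I.K I.z₀) z ∧
      ∀ i < I.inputLength, σ .bestCycle i 0 = (I.atIndex z.1 i).val := by
  obtain ⟨z, hz, hradius, hcycle⟩ := h.exists_cycle
  refine ⟨z, isMinRadiusCycle_of_le len_le_sum_encode ?_ hz hradius fun p =>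
    h.le_eccentricity p (p.2.trans_le n_le_inputLength), hcycle⟩
  exact Nat.lt_one_add_iff.2 (Nat.mul_le_mul_right _ n_le_inputLength)

theorem bestSoFar_exec_minRadiusCycle :
    BestSoFar I I.inputLength (minRadiusCycle.exec I.encode env σ) := by
  suffices hloop : Prepared I (minRadiusCycle.exec I.encode env σ) ∧
      BestSoFar I I.inputLength (minRadiusCycle.exec I.encode env σ) from hloop.2
  exact fold_induction (fun m (σ' : Tables Table) => Prepared I σ' ∧ BestSoFar I m σ')
    ⟨prepared_exec_prepare, bestSoFar_exec_prepare⟩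
    fun _ _ σ' ⟨hσ', hbest⟩ => ⟨hσ'.exec tryCenter (by decide), hbest.exec_tryCenter hσ'⟩

theorem solution_of_isMinRadiusCycle {z : Cycles I.K I.d} {f : ℕ → ℕ}
    (hz : IsMinRadiusCycle I.len (homologyClass I.K I.z₀) z)
    (hf : ∀ i < I.simplices.length, f i = (I.atIndex z.1 i).val) :
    I.Solution ((List.range I.simplices.length).map f) := by
  refine ⟨z, hz, List.ext_getElem (by simp [encodeCycle]) fun i hi _ => ?_⟩
  have hi' : i < I.simplices.length := by simpa using hi
  simp only [encodeCycle, List.getElem_map, List.getElem_range, hf i hi', valueAt_getElem _ hi']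

end CycleLocalization

/-- A representative cycle of minimal radius of a given mod 2 homology class of a finite simplicial
complex can be computed in polynomial time. -/
theorem mainTheorem4 :
    RAM.PolyTimeSolvable CycleLocalization.Instance.encode CycleLocalization.Instance.Solution := by
  open CycleLocalization Instance RAM.Expr in
  refine RAM.polyTimeSolvable_of_cmd minRadiusCycle (load₁ .bestCycle (.var 0)) numSimplices
    (fun _ => length_simplices_le) fun I => ?_
  obtain ⟨z, hz, hcycle⟩ := (bestSoFar_exec_minRadiusCycle (I := I)).exists_isMinRadiusCycle
  refine solution_of_isMinRadiusCycle hz fun i hi => ?_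
  have hi' : i < I.inputLength := hi.trans_le length_simplices_le
  exact (eval_load₁ (i := i) rfl hi').trans (hcycle i hi')
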